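/- Let $X$ be a real random variable with $\operatorname{Var} X = 1$ and characteristic function $f(t)=\mathbb{E}\,e^{itX}$, let $X_1,X_2,\dots$ be independent copies of $X$, and put $Z_k = (X_1+\dots+X_k)/\sqrt{k}$ for $k\ge 1$. Suppose that for some integer $n_0\ge 1$ the random variable $Z_{n_0}$ has a density with respect to Lebesgue measure on $\mathbb{R}$ that is bounded by a constant $M$. Then for all $0<\varepsilon\le 1$ and all integers $n\ge 4n_0$, the function $|f|^n$ is integrable on $\{|t|\ge\varepsilon\}$ and $$\int_{|t|\ge\varepsilon}|f(t)|^n\,dt\;\le\;\frac{4\pi M}{\sqrt{2n}}\,\exp\Big\{-\frac{n\varepsilon^2}{C\,n_0M^2}\Big\},\qquad C=5200.$$ -/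

import Mathlib

open MeasureTheory ProbabilityTheory

/-- The normalized sum `Z_n = (X_1 + ⋯ + X_n) / √n` of a sequence of real random variables,
indexed from `0`. -/
noncomputable def normalizedSum {Ω : Type*} (Xs : ℕ → Ω → ℝ) (n : ℕ) (ω : Ω) : ℝ :=
  (∑ i ∈ Finset.range n, Xs i ω) / √(n : ℝ)

/-- The real random variable `Z` has, under `P`, a density (with respect to Lebesgue measure)
that is bounded by `M` everywhere. -/
def HasDensityBoundedBy {Ω : Type*} [MeasurableSpace Ω] (P : Measure Ω) (Z : Ω → ℝ) (M : ℝ) :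
    Prop :=
  ∃ p : ℝ → ℝ, Measurable p ∧ (∀ x, 0 ≤ p x) ∧ (∀ x, p x ≤ M) ∧
    P.map Z = volume.withDensity (fun x => ENNReal.ofReal (p x))

/-! Let `μ` be the law of `Z_{n₀}`. Since |f(t)|^n = |φ(√n₀ t)|^s with φ the characteristic function
of `μ` and s = n/n₀ ≥ 4, it suffices to bound tail integrals of |φ|^s for a law of variance 1 with
density at most M. Two ingredients are combined in `integral_norm_charFun_rpow_tail_le`.

The first is a sharp bound for even moments: ∫|φ|^{2k} ≤ 2πM·S_k with S_k = (1/π)∫ sinc^{2k}, the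
value attained by a uniform density of height M (`integral_norm_charFun_pow_le`). Stratifying by the
quantile function makes φ an average of normalized N-point exponential sums whose frequencies are
1/(NM)-separated. The 2k-th power of the modulus of such a sum is the exponential sum over all
2k-fold signed sums, which split into separated chains exactly as a tensor power of an irreducible
representation of SU(2) splits into irreducibles (`exists_norm_seqExpSum_pow_eq`). Each chain has a
small integral against a Gaussian, and character integrals count the chains. Letting N → ∞ and then
flattening the Gaussian gives S_k. Estimates of S_k, interpolated in the exponent, give ∫|φ|^s ≤
2πM·0.985·√(2/s) for real s ≥ 4.

The second is a pointwise bound |φ(u)| ≤ exp(-ε²/(85M²)) for |u| ≥ ε (`norm_charFun_le_exp`): a law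
with bounded density and variance 1 cannot concentrate near a lattice.

If sε²/M² is small, the factor 0.985 already pays for the exponential. Otherwise about half of the
exponent s is spent on the pointwise bound and the rest on an even moment. -/

/-! ### Chain decomposition of products of exponential sums. -/

/-- The exponential sum `∑ exp (i t c_j)` of a finite sequence of reals, the sequence being given as
a function on `ℕ` together with a length. -/
noncomputable def seqExpSum (c : (ℕ → ℝ) × ℕ) (t : ℝ) : ℂ :=
  ∑ i ∈ Finset.range c.2, Complex.exp (((t * c.1 i : ℝ) : ℂ) * Complex.I)

/-- Consecutive terms of the finite sequence increase by at least `δ`. -/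
def IsSeparated (δ : ℝ) (c : (ℕ → ℝ) × ℕ) : Prop :=
  ∀ i, i + 1 < c.2 → c.1 i + δ ≤ c.1 (i + 1)

/-- The ratio `sin (ℓ x) / sin x`, the character of the irreducible representation of `SU(2)`
of dimension `ℓ`. -/
noncomputable def sinRatio (ℓ : ℕ) (x : ℝ) : ℝ := Real.sin (ℓ * x) / Real.sin x

theorem sinRatio_zero (x : ℝ) : sinRatio 0 x = 0 := by simp [sinRatio]

theorem sinRatio_one {x : ℝ} (hx : Real.sin x ≠ 0) : sinRatio 1 x = 1 := by simp [sinRatio, hx]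

/-- One step of the Clebsch–Gordan rule: the top component splits off and both dimensions drop by
one. -/
theorem sinRatio_mul_succ (a b : ℕ) {x : ℝ} (hx : Real.sin x ≠ 0) :
    sinRatio (a + 1) x * sinRatio (b + 1) x =
      sinRatio (a + b + 1) x + sinRatio a x * sinRatio b x := by
  have key : Real.sin ((a + 1 : ℕ) * x) * Real.sin ((b + 1 : ℕ) * x) =
      Real.sin ((a + b + 1 : ℕ) * x) * Real.sin x + Real.sin (a * x) * Real.sin (b * x) := by
    push_cast
    have h1 : ((a : ℝ) + b + 1) * x = a * x + (b * x + x) := by ring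
    rw [h1, add_mul, add_mul, one_mul, Real.sin_add, Real.sin_add, Real.sin_add, Real.cos_add,
      Real.sin_add]
    have h2 := Real.sin_sq_add_cos_sq x
    linear_combination (Real.sin (a * x) * Real.sin (b * x)) * h2
  unfold sinRatio
  rw [div_mul_div_comm, div_mul_div_comm, key]
  field_simp

/-- The sums a_i + b_j form a grid. Removing one hook (a full side, then a full adjacent side)
leaves a grid with both sides shorter by one, so hook lengths obey the recursion
`sinRatio_mul_succ`. The same list `C` therefore decomposes both the exponential sums and the
characters. The parity of the lengths is recorded because only odd characters are integrated later.
-/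
theorem exists_seqExpSum_mul_eq (δ : ℝ) (N : ℕ) : ∀ (ℓ : ℕ) (a b : ℕ → ℝ),
    IsSeparated δ (a, ℓ) → IsSeparated δ (b, N) →
    ∃ C : List ((ℕ → ℝ) × ℕ), (∀ c ∈ C, IsSeparated δ c ∧ c.2 % 2 = (ℓ + N + 1) % 2) ∧
      (∀ t, seqExpSum (a, ℓ) t * seqExpSum (b, N) t = (C.map fun c => seqExpSum c t).sum) ∧
      (∀ x, Real.sin x ≠ 0 →
        sinRatio ℓ x * sinRatio N x = (C.map fun c => sinRatio c.2 x).sum) := by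
  induction N with
  | zero =>
    intro ℓ a b _ _
    exact ⟨[], by simp, by simp [seqExpSum], by simp [sinRatio_zero]⟩
  | succ N ih =>
    intro ℓ a b ha hb
    cases ℓ with
    | zero => exact ⟨[], by simp, by simp [seqExpSum], by simp [sinRatio_zero]⟩
    | succ ℓ =>
      obtain ⟨C, hC, hE, hS⟩ := ih ℓ a (fun j => b (j + 1))
        (fun i hi => ha i (by simp only at hi ⊢; omega))
        (fun i hi => hb (i + 1) (by simp only at hi ⊢; omega))
      -- The hook: a_0, …, a_ℓ with b_0 added, then a_ℓ with b_1, …, b_N added. Each step changes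
      -- one index by one, so the gap `δ` is inherited.
      set h : ℕ → ℝ := fun i => if i ≤ ℓ then a i + b 0 else a ℓ + b (i - ℓ) with hh
      have hle : ∀ i, i ≤ ℓ → h i = a i + b 0 := fun i hi => if_pos hi
      have hgt : ∀ i, ¬ i ≤ ℓ → h i = a ℓ + b (i - ℓ) := fun i hi => if_neg hi
      refine ⟨(h, ℓ + N + 1) :: C, ?_, ?_, ?_⟩
      · intro c hc
        rcases List.mem_cons.1 hc with rfl | hc
        · refine ⟨?_, by simp only; omega⟩
          intro i hi
          simp only at hi ⊢
          by_cases h1 : i + 1 ≤ ℓ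
          · have := ha i (by simp only; omega)
            rw [hle _ h1, hle i (by omega)]
            simp only at this
            linarith
          · by_cases h2 : i = ℓ
            · subst h2
              have := hb 0 (by simp only; omega)
              rw [hle i le_rfl, hgt _ h1, (by omega : i + 1 - i = 0 + 1)]
              simp only at this
              linarith
            · have := hb (i - ℓ) (by simp only; omega)
              rw [hgt _ h1, hgt i (by omega), (by omega : i + 1 - ℓ = i - ℓ + 1)]
              simp only at this
              linarith
        · obtain ⟨h1, h2⟩ := hC c hc
          exact ⟨h1, by omega⟩
      · intro t
        rw [List.map_cons, List.sum_cons, ← hE t]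
        unfold seqExpSum
        simp only
        rw [show ℓ + N + 1 = (ℓ + 1) + N by ring, Finset.sum_range_add _ (ℓ + 1) N,
          Finset.sum_range_succ' (fun j => Complex.exp (((t * b j : ℝ) : ℂ) * Complex.I))]
        have e1 : ∀ i ∈ Finset.range (ℓ + 1),
            Complex.exp (((t * h i : ℝ) : ℂ) * Complex.I) =
            Complex.exp (((t * a i : ℝ) : ℂ) * Complex.I) *
              Complex.exp (((t * b 0 : ℝ) : ℂ) * Complex.I) := by
          intro i hi
          have : i ≤ ℓ := by have := Finset.mem_range.1 hi; omega
          rw [← Complex.exp_add]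
          rw [hle i this]
          congr 1; push_cast; ring
        have e2 : ∀ i ∈ Finset.range N,
            Complex.exp (((t * h (ℓ + 1 + i) : ℝ) : ℂ) * Complex.I) =
            Complex.exp (((t * a ℓ : ℝ) : ℂ) * Complex.I) *
              Complex.exp (((t * b (i + 1) : ℝ) : ℂ) * Complex.I) := by
          intro i hi
          rw [← Complex.exp_add]
          rw [hgt _ (by omega), (by omega : ℓ + 1 + i - ℓ = i + 1)]
          congr 1; push_cast; ring
        rw [Finset.sum_congr rfl e1, Finset.sum_congr rfl e2, ← Finset.sum_mul, ← Finset.mul_sum,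
          Finset.sum_range_succ]
        ring
      · intro x hx
        rw [List.map_cons, List.sum_cons, ← hS x hx, sinRatio_mul_succ _ _ hx]

theorem exists_list_seqExpSum_mul_eq {δ : ℝ} {N p : ℕ} {b : ℕ → ℝ} (hb : IsSeparated δ (b, N)) :
    ∀ C : List ((ℕ → ℝ) × ℕ), (∀ c ∈ C, IsSeparated δ c ∧ c.2 % 2 = p % 2) →
    ∃ C' : List ((ℕ → ℝ) × ℕ), (∀ c ∈ C', IsSeparated δ c ∧ c.2 % 2 = (p + N + 1) % 2) ∧
      (∀ t, (C.map fun c => seqExpSum c t).sum * seqExpSum (b, N) t =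
        (C'.map fun c => seqExpSum c t).sum) ∧
      (∀ x, Real.sin x ≠ 0 → (C.map fun c => sinRatio c.2 x).sum * sinRatio N x =
        (C'.map fun c => sinRatio c.2 x).sum) := by
  intro C
  induction C with
  | nil => exact fun _ => ⟨[], by simp, by simp, by simp⟩
  | cons c C ih =>
    intro h
    obtain ⟨C', h1, h2, h3⟩ := ih (fun d hd => h d (List.mem_cons_of_mem _ hd))
    obtain ⟨hc, hp⟩ := h c List.mem_cons_self
    obtain ⟨D, g1, g2, g3⟩ := exists_seqExpSum_mul_eq δ N c.2 c.1 b hc hb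
    refine ⟨D ++ C', ?_, ?_, ?_⟩
    · intro d hd
      rcases List.mem_append.1 hd with hd | hd
      · exact ⟨(g1 d hd).1, by have := (g1 d hd).2; omega⟩
      · exact h1 d hd
    · intro t
      rw [List.map_cons, List.sum_cons, add_mul, h2, g2, List.map_append, List.sum_append]
    · intro x hx
      rw [List.map_cons, List.sum_cons, add_mul, h3 x hx, g3 x hx, List.map_append,
        List.sum_append]

theorem isSeparated_reflect {δ : ℝ} {N : ℕ} {x : ℕ → ℝ} (hx : IsSeparated δ (x, N)) :
    IsSeparated δ (fun j => -x (N - 1 - j), N) := by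
  intro i hi
  simp only at hi ⊢
  have := hx (N - 1 - (i + 1)) (by simp only; omega)
  simp only [(by omega : N - 1 - (i + 1) + 1 = N - 1 - i)] at this
  linarith

theorem seqExpSum_reflect (N : ℕ) (x : ℕ → ℝ) (t : ℝ) :
    seqExpSum (fun j => -x (N - 1 - j), N) t = (starRingEnd ℂ) (seqExpSum (x, N) t) := by
  unfold seqExpSum
  simp only
  rw [Finset.sum_range_reflect (fun j => Complex.exp (((t * -x j : ℝ) : ℂ) * Complex.I)), map_sum]
  refine Finset.sum_congr rfl fun i _ => ?_
  rw [← Complex.exp_conj]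
  simp

/-- The symmetric chain decomposition of the `2k`-fold sums `±x_{i₁} ± ⋯ ± x_{i₂ₖ}`. -/
theorem exists_norm_seqExpSum_pow_eq {δ : ℝ} {N : ℕ} {x : ℕ → ℝ} (hx : IsSeparated δ (x, N))
    (k : ℕ) :
    ∃ C : List ((ℕ → ℝ) × ℕ), (∀ c ∈ C, IsSeparated δ c ∧ c.2 % 2 = 1) ∧
      (∀ t, ((‖seqExpSum (x, N) t‖ ^ (2 * k) : ℝ) : ℂ) = (C.map fun c => seqExpSum c t).sum) ∧
      (∀ y, Real.sin y ≠ 0 → sinRatio N y ^ (2 * k) = (C.map fun c => sinRatio c.2 y).sum) := by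
  induction k with
  | zero =>
    refine ⟨[(fun _ => 0, 1)], ?_, ?_, ?_⟩
    · simp [IsSeparated]
    · simp [seqExpSum]
    · intro y hy
      simp [sinRatio_one hy]
  | succ k ih =>
    obtain ⟨C, h1, h2, h3⟩ := ih
    obtain ⟨D, g1, g2, g3⟩ := exists_list_seqExpSum_mul_eq (p := 1) hx C (by simpa using h1)
    -- The reflected sequence supplies the conjugate factor, so two multiplications raise the power
    -- of the modulus by 2.
    obtain ⟨E, f1, f2, f3⟩ :=
      exists_list_seqExpSum_mul_eq (p := 1 + N + 1) (isSeparated_reflect hx) D g1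
    refine ⟨E, fun c hc => ⟨(f1 c hc).1, by have := (f1 c hc).2; omega⟩, ?_, ?_⟩
    · intro t
      rw [← f2, ← g2, ← h2, seqExpSum_reflect, mul_assoc, Complex.mul_conj,
        Complex.normSq_eq_norm_sq]
      push_cast; ring
    · intro y hy
      rw [← f3 y hy, ← g3 y hy, ← h3 y hy]; ring

/-! ### Counting the chains by integrating characters. -/

/-- The ratio equals 1 + 2∑_{j≤m} cos 2jx away from zeros of the sine, and the cosines integrate to
zero. Every odd chain thus contributes the same amount π, whatever its length. -/
theorem integral_sinRatio_odd (m : ℕ) :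
    IntervalIntegrable (sinRatio (2 * m + 1)) volume 0 Real.pi ∧
      ∫ x in (0 : ℝ)..Real.pi, sinRatio (2 * m + 1) x = Real.pi := by
  have key : ∀ m : ℕ, ∃ g : ℝ → ℝ, Continuous g ∧
      (∀ x ∈ Set.Ioo 0 Real.pi, sinRatio (2 * m + 1) x = g x) ∧
      ∫ x in (0 : ℝ)..Real.pi, g x = Real.pi := by
    intro m
    induction m with
    | zero =>
      refine ⟨fun _ => 1, by fun_prop, fun x hx => ?_, by simp⟩
      exact sinRatio_one (Real.sin_pos_of_pos_of_lt_pi hx.1 hx.2).ne'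
    | succ m ih =>
      obtain ⟨g, hg, h1, h2⟩ := ih
      refine ⟨fun x => g x + 2 * Real.cos ((2 * m + 2 : ℕ) * x), by fun_prop, fun x hx => ?_, ?_⟩
      · have hs := (Real.sin_pos_of_pos_of_lt_pi hx.1 hx.2).ne'
        simp only
        rw [← h1 x hx]
        unfold sinRatio
        rw [div_add' _ _ _ hs]
        congr 1
        push_cast
        have e1 : (2 * ((m : ℝ) + 1) + 1) * x = (2 * m + 2) * x + x := by ring
        have e2 : (2 * (m : ℝ) + 1) * x = (2 * m + 2) * x - x := by ring
        rw [e1, e2, Real.sin_add, Real.sin_sub]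
        ring
      · rw [intervalIntegral.integral_add (hg.intervalIntegrable _ _)
          (by apply Continuous.intervalIntegrable; fun_prop), h2,
          intervalIntegral.integral_const_mul,
          intervalIntegral.integral_comp_mul_left (fun x => Real.cos x) (by positivity)]
        simp only [integral_cos, smul_eq_mul, mul_zero, Real.sin_zero, sub_zero, Real.sin_nat_mul_pi]
        ring
  obtain ⟨g, hg, h1, h2⟩ := key m
  have hae : ∀ᵐ x, x ∈ Set.uIoc 0 Real.pi → g x = sinRatio (2 * m + 1) x := by
    have : ∀ᵐ x : ℝ, x ≠ Real.pi := by
      simp [ae_iff]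
    filter_upwards [this] with x hx hx'
    rw [Set.uIoc_of_le Real.pi_pos.le] at hx'
    exact (h1 x ⟨hx'.1, lt_of_le_of_ne hx'.2 hx⟩).symm
  refine ⟨?_, ?_⟩
  · refine (hg.intervalIntegrable 0 Real.pi).congr_ae ?_
    rw [Filter.EventuallyEq, ae_restrict_iff' measurableSet_uIoc]
    exact hae
  · exact (intervalIntegral.integral_congr_ae hae).symm.trans h2

theorem integral_sum_sinRatio {C : List ((ℕ → ℝ) × ℕ)} (hC : ∀ c ∈ C, c.2 % 2 = 1) :
    IntervalIntegrable (fun x => (C.map fun c => sinRatio c.2 x).sum) volume 0 Real.pi ∧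
    ∫ x in (0 : ℝ)..Real.pi, (C.map fun c => sinRatio c.2 x).sum = Real.pi * C.length := by
  induction C with
  | nil => simp
  | cons c C ih =>
    obtain ⟨h1, h2⟩ := ih (fun d hd => hC d (List.mem_cons_of_mem _ hd))
    have hc := hC c List.mem_cons_self
    obtain ⟨m, hm⟩ : ∃ m, c.2 = 2 * m + 1 := ⟨c.2 / 2, by omega⟩
    obtain ⟨g1, g2⟩ := integral_sinRatio_odd m
    simp only [List.map_cons, List.sum_cons, hm, List.length_cons]
    refine ⟨g1.add h1, ?_⟩
    rw [intervalIntegral.integral_add g1 h1, g2, h2]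
    push_cast; ring

theorem length_eq_integral_sinRatio_pow {C : List ((ℕ → ℝ) × ℕ)} {N k : ℕ}
    (hC : ∀ c ∈ C, c.2 % 2 = 1)
    (h : ∀ y, Real.sin y ≠ 0 → sinRatio N y ^ (2 * k) = (C.map fun c => sinRatio c.2 y).sum) :
    (C.length : ℝ) = (∫ x in (0 : ℝ)..Real.pi, sinRatio N x ^ (2 * k)) / Real.pi := by
  have hae : ∀ᵐ x, x ∈ Set.uIoc 0 Real.pi →
      sinRatio N x ^ (2 * k) = (C.map fun c => sinRatio c.2 x).sum := by
    have : ∀ᵐ x : ℝ, x ≠ Real.pi := by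
      simp [ae_iff]
    filter_upwards [this] with x hx hx'
    rw [Set.uIoc_of_le Real.pi_pos.le] at hx'
    exact h x (Real.sin_pos_of_pos_of_lt_pi hx'.1 (lt_of_le_of_ne hx'.2 hx)).ne'
  rw [intervalIntegral.integral_congr_ae hae, (integral_sum_sinRatio hC).2]
  field_simp

/-! ### Gaussian-weighted integrals of separated exponential sums. -/

theorem sum_gaussian_le_of_mul_le {a δ : ℝ} (ha : 0 < a) (hδ : 0 < δ) (n : ℕ) {d : ℕ → ℝ}
    (hd : ∀ i < n, i * δ ≤ d i) :
    ∑ i ∈ Finset.range n, Real.exp (-a * d i ^ 2) ≤ 1 + √(Real.pi / (a * δ ^ 2)) / 2 := by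
  set f : ℝ → ℝ := fun u => Real.exp (-(a * δ ^ 2) * u ^ 2) with hf
  have hc : 0 < a * δ ^ 2 := by positivity
  have h1 : ∀ i ∈ Finset.range n, Real.exp (-a * d i ^ 2) ≤ f i := by
    intro i hi
    have := hd i (Finset.mem_range.1 hi)
    refine Real.exp_le_exp.2 ?_
    have h2 : (i * δ) ^ 2 ≤ d i ^ 2 := pow_le_pow_left₀ (by positivity) this 2
    nlinarith
  refine (Finset.sum_le_sum h1).trans ?_
  have h3 : ∑ i ∈ Finset.range n, f i ≤ ∑ i ∈ Finset.range (n + 1), f i :=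
    Finset.sum_le_sum_of_subset_of_nonneg (Finset.range_mono (Nat.le_succ n))
      fun _ _ _ => (Real.exp_pos _).le
  refine h3.trans ?_
  rw [Finset.sum_range_succ', add_comm]
  have hanti : AntitoneOn f (Set.Icc 0 (n : ℝ)) := by
    intro x hx y hy hxy
    refine Real.exp_le_exp.2 ?_
    have h2 : x ^ 2 ≤ y ^ 2 := pow_le_pow_left₀ hx.1 hxy 2
    nlinarith
  have := hanti.sum_range_le_integral (integrable_exp_neg_mul_sq hc).integrableOn
    (fun t _ => (Real.exp_pos _).le)
  have hI : ∫ x in Set.Ioi 0, f x = √(Real.pi / (a * δ ^ 2)) / 2 := integral_gaussian_Ioi _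
  rw [hI] at this
  have h0 : f ((0 : ℕ) : ℝ) = 1 := by simp [hf]
  rw [h0]
  linarith

theorem sum_gaussian_le_of_isSeparated {a δ : ℝ} (ha : 0 < a) (hδ : 0 < δ) {c : (ℕ → ℝ) × ℕ}
    (hc : IsSeparated δ c) :
    ∑ i ∈ Finset.range c.2, Real.exp (-a * c.1 i ^ 2) ≤ 2 + √(Real.pi / (a * δ ^ 2)) := by
  have hmono : ∀ i j, i + j < c.2 → c.1 i + j * δ ≤ c.1 (i + j) := by
    intro i j
    induction j with
    | zero => simp
    | succ j ih =>
      intro h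
      have h1 := ih (by omega)
      have h2 := hc (i + j) (by omega)
      rw [← add_assoc]
      push_cast
      linarith
  -- `m` is where the chain changes sign; on each side the points move away from 0 with gaps at
  -- least `δ`.
  obtain ⟨m, hm, hm1, hm2⟩ : ∃ m, m ≤ c.2 ∧ (∀ i < m, c.1 i < 0) ∧
      (∀ i, m ≤ i → i < c.2 → 0 ≤ c.1 i) := by
    by_cases h : ∃ i, i < c.2 ∧ 0 ≤ c.1 i
    · refine ⟨Nat.find h, (Nat.find_spec h).1.le, fun i hi => ?_, fun i hi hi' => ?_⟩
      · have := Nat.find_min h hi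
        by_contra hcon
        exact this ⟨hi.trans (Nat.find_spec h).1, not_lt.1 hcon⟩
      · have h1 := hmono (Nat.find h) (i - Nat.find h) (by omega)
        rw [Nat.add_sub_cancel' hi] at h1
        have h2 := (Nat.find_spec h).2
        have : 0 ≤ ((i - Nat.find h : ℕ) : ℝ) * δ := by positivity
        linarith
    · push Not at h
      exact ⟨c.2, le_rfl, h, fun i h1 h2 => by omega⟩
  obtain ⟨r, hr⟩ := Nat.exists_eq_add_of_le hm
  rw [hr, Finset.sum_range_add, ← Finset.sum_range_reflect]
  have e1 : ∑ j ∈ Finset.range m, Real.exp (-a * c.1 (m - 1 - j) ^ 2) ≤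
      1 + √(Real.pi / (a * δ ^ 2)) / 2 := by
    simp_rw [← neg_sq (c.1 _)]
    refine sum_gaussian_le_of_mul_le ha hδ m (d := fun j => -c.1 (m - 1 - j)) fun i hi => ?_
    have h1 := hmono (m - 1 - i) i (by omega)
    have h2 := hm1 (m - 1 - i + i) (by omega)
    linarith
  have e2 : ∑ j ∈ Finset.range r, Real.exp (-a * c.1 (m + j) ^ 2) ≤
      1 + √(Real.pi / (a * δ ^ 2)) / 2 := by
    refine sum_gaussian_le_of_mul_le ha hδ r (d := fun j => c.1 (m + j)) fun i hi => ?_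
    have h1 := hmono m i (by omega)
    have h2 := hm2 m le_rfl (by omega)
    linarith
  linarith

/-- The Fourier transform of a Gaussian is a positive Gaussian, so a chain's integral is a sum of
Gaussian values at its points, which separation controls. -/
theorem integrable_seqExpSum_mul_gaussian {b : ℝ} (hb : 0 < b) (c : (ℕ → ℝ) × ℕ) :
    Integrable (fun t : ℝ => seqExpSum c t * (Real.exp (-b * t ^ 2) : ℂ)) ∧
    ∫ t : ℝ, seqExpSum c t * (Real.exp (-b * t ^ 2) : ℂ) =
      ((√(Real.pi / b) * ∑ i ∈ Finset.range c.2, Real.exp (-(1 / (4 * b)) * c.1 i ^ 2) : ℝ) : ℂ) := by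
  have hb' : 0 < (b : ℂ).re := by simpa
  have e : ∀ y t : ℝ, Complex.exp (((t * y : ℝ) : ℂ) * Complex.I) * (Real.exp (-b * t ^ 2) : ℂ) =
      Complex.exp (Complex.I * (y : ℂ) * t) * Complex.exp (-(b : ℂ) * t ^ 2) := by
    intro y t
    push_cast
    ring_nf
  have hint : ∀ y : ℝ, Integrable fun t : ℝ =>
      Complex.exp (Complex.I * (y : ℂ) * t) * Complex.exp (-(b : ℂ) * t ^ 2) := by
    intro y
    refine (integrable_cexp_quadratic hb' (Complex.I * y) 0).congr ?_
    filter_upwards with t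
    rw [← Complex.exp_add]
    congr 1; ring
  unfold seqExpSum
  simp_rw [Finset.sum_mul, e]
  refine ⟨integrable_finsetSum _ fun i _ => hint _, ?_⟩
  rw [integral_finsetSum _ fun i _ => hint _]
  simp_rw [fourierIntegral_gaussian hb']
  rw [← Finset.mul_sum]
  have hs : ((Real.pi : ℂ) / b) ^ (1 / 2 : ℂ) = ((√(Real.pi / b) : ℝ) : ℂ) := by
    rw [Real.sqrt_eq_rpow, Complex.ofReal_cpow (by positivity)]
    push_cast; rfl
  rw [hs]
  push_cast
  congr 1
  refine Finset.sum_congr rfl fun i _ => ?_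
  congr 1
  field_simp

theorem integral_norm_seqExpSum_pow_mul_gaussian_le {b δ : ℝ} (hb : 0 < b) (hδ : 0 < δ) {N : ℕ}
    {x : ℕ → ℝ} (hx : IsSeparated δ (x, N)) (k : ℕ) :
    ∫ t : ℝ, ‖seqExpSum (x, N) t‖ ^ (2 * k) * Real.exp (-b * t ^ 2) ≤
      (∫ y in (0 : ℝ)..Real.pi, sinRatio N y ^ (2 * k)) / Real.pi *
        (2 * √(Real.pi / b) + 2 * Real.pi / δ) := by
  obtain ⟨C, h1, h2, h3⟩ := exists_norm_seqExpSum_pow_eq hx k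
  rw [← length_eq_integral_sinRatio_pow (fun c hc => (h1 c hc).2) h3]
  have hC := fun c hc => (h1 c hc).1
  have key : ∀ D : List ((ℕ → ℝ) × ℕ), (∀ c ∈ D, IsSeparated δ c) →
      Integrable (fun t : ℝ => (D.map fun c => seqExpSum c t).sum * (Real.exp (-b * t ^ 2) : ℂ)) ∧
      ∃ r : ℝ, r ≤ D.length * (2 * √(Real.pi / b) + 2 * Real.pi / δ) ∧
      ∫ t : ℝ, (D.map fun c => seqExpSum c t).sum * (Real.exp (-b * t ^ 2) : ℂ) = (r : ℂ) := by
    intro D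
    induction D with
    | nil => exact fun _ => ⟨by simp, 0, by simp, by simp⟩
    | cons c D ih =>
      intro h
      obtain ⟨i1, r, i2, i3⟩ := ih (fun d hd => h d (List.mem_cons_of_mem _ hd))
      obtain ⟨j1, j2⟩ := integrable_seqExpSum_mul_gaussian hb c
      simp only [List.map_cons, List.sum_cons, add_mul, List.length_cons]
      refine ⟨j1.add i1, √(Real.pi / b) * ∑ i ∈ Finset.range c.2,
        Real.exp (-(1 / (4 * b)) * c.1 i ^ 2) + r, ?_, ?_⟩
      · have h4 := sum_gaussian_le_of_isSeparated (a := 1 / (4 * b)) (by positivity) hδ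
          (h c List.mem_cons_self)
        have h5 := mul_le_mul_of_nonneg_left h4 (Real.sqrt_nonneg (Real.pi / b))
        have h6 : √(Real.pi / b) * √(Real.pi / (1 / (4 * b) * δ ^ 2)) = 2 * Real.pi / δ := by
          rw [← Real.sqrt_mul (by positivity)]
          rw [show Real.pi / b * (Real.pi / (1 / (4 * b) * δ ^ 2)) = (2 * Real.pi / δ) ^ 2 by
            field_simp; ring]
          exact Real.sqrt_sq (by positivity)
        push_cast
        linarith
      · rw [integral_add j1 i1, j2, i3]
        push_cast; ring
  obtain ⟨-, r, hr, hr'⟩ := key C hC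
  have : ((∫ t : ℝ, ‖seqExpSum (x, N) t‖ ^ (2 * k) * Real.exp (-b * t ^ 2) : ℝ) : ℂ) = (r : ℂ) := by
    rw [← hr', ← integral_complex_ofReal]
    refine integral_congr_ae ?_
    filter_upwards with t
    rw [← h2]; push_cast; rfl
  rw [Complex.ofReal_injective this]
  exact hr

/-! ### From separated points to laws with bounded density. -/

theorem cdf_sub_cdf_le {μ : Measure ℝ} [IsProbabilityMeasure μ] {M : ℝ}
    (hμ : μ ≤ ENNReal.ofReal M • (volume : Measure ℝ)) (hM : 0 ≤ M) {a b : ℝ} (hab : a ≤ b) :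
    cdf μ b - cdf μ a ≤ M * (b - a) := by
  have h1 : μ.real (Set.Ioc a b) = cdf μ b - cdf μ a := by
    rw [cdf_eq_real, cdf_eq_real, ← Set.Iic_sdiff_Iic, measureReal_sdiff (Set.Iic_subset_Iic.2 hab)
      measurableSet_Iic]
  rw [← h1]
  have h2 := hμ (Set.Ioc a b)
  rw [Measure.smul_apply, Real.volume_Ioc, smul_eq_mul, ← ENNReal.ofReal_mul hM] at h2
  exact ENNReal.toReal_le_of_le_ofReal (mul_nonneg hM (by linarith)) h2

/-- A quantile function of a law with density at most `M`. -/
theorem exists_quantile {μ : Measure ℝ} [IsProbabilityMeasure μ] {M : ℝ} (hM : 0 < M)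
    (hμ : μ ≤ ENNReal.ofReal M • (volume : Measure ℝ)) :
    ∃ α : ℝ → ℝ, Measurable α ∧
      (∀ u ∈ Set.Ioo (0 : ℝ) 1, ∀ v ∈ Set.Ioo (0 : ℝ) 1, u ≤ v → v - u ≤ M * (α v - α u)) ∧
      Measure.map α (volume.restrict (Set.Ioo (0 : ℝ) 1)) = μ := by
  have hF : ∀ a b, a ≤ b → cdf μ b - cdf μ a ≤ M * (b - a) := fun a b => cdf_sub_cdf_le hμ hM.le
  have hmono : Monotone (cdf μ) := monotone_cdf μ
  have hcont : Continuous (cdf μ) := by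
    refine (LipschitzWith.of_le_add_mul M.toNNReal fun x y => ?_).continuous
    rw [Real.coe_toNNReal _ hM.le, Real.dist_eq]
    rcases le_total x y with h | h
    · have := hmono h
      have : 0 ≤ M * |x - y| := by positivity
      linarith
    · have := hF y x h
      rw [abs_of_nonneg (by linarith)]
      linarith
  have hex : ∀ u, u ∈ Set.Ioo (0 : ℝ) 1 → ∃ a, cdf μ a = u := by
    intro u hu
    have h1 := ((tendsto_cdf_atBot μ).eventually_le_const hu.1).exists
    have h2 := ((tendsto_cdf_atTop μ).eventually_const_le hu.2).exists
    exact mem_range_of_exists_le_of_exists_ge hcont h1 h2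
  choose! α₀ hα₀ using hex
  -- Any right inverse of the distribution function will do on (0,1); outside, `α` is 0 and only
  -- measurability matters.
  set α : ℝ → ℝ := (Set.Ioo (0 : ℝ) 1).indicator α₀ with hα
  have hα1 : ∀ u ∈ Set.Ioo (0 : ℝ) 1, cdf μ (α u) = u := by
    intro u hu
    rw [hα, Set.indicator_of_mem hu]
    exact hα₀ u hu
  have hlt : ∀ u ∈ Set.Ioo (0 : ℝ) 1, ∀ v ∈ Set.Ioo (0 : ℝ) 1, u ≤ v → α u ≤ α v := by
    intro u hu v hv huv
    by_contra hcon
    push Not at hcon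
    have := hmono hcon.le
    rw [hα1 u hu, hα1 v hv] at this
    have : u = v := le_antisymm huv this
    rw [this] at hcon
    exact lt_irrefl _ hcon
  have hmeasS : ∀ x, MeasurableSet (Set.Ioo (0 : ℝ) 1 ∩ {u | α u ≤ x}) := by
    intro x
    refine Set.OrdConnected.measurableSet ⟨fun u hu v hv w hw => ?_⟩
    have hw' : w ∈ Set.Ioo (0 : ℝ) 1 := ⟨hu.1.1.trans_le hw.1, hw.2.trans_lt hv.1.2⟩
    exact ⟨hw', (hlt w hw' v hv.1 hw.2).trans hv.2⟩
  have hmeas : Measurable α := by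
    refine measurable_of_Iic fun x => ?_
    have : α ⁻¹' Set.Iic x = (Set.Ioo (0 : ℝ) 1 ∩ {u | α u ≤ x}) ∪
        ((Set.Ioo (0 : ℝ) 1)ᶜ ∩ {_u | (0 : ℝ) ≤ x}) := by
      ext u
      by_cases hu : u ∈ Set.Ioo (0 : ℝ) 1
      · simp [hu]
      · simp only [Set.mem_preimage, Set.mem_Iic, Set.mem_union, Set.mem_inter_iff, hu, false_and,
          Set.mem_compl_iff, not_false_eq_true, true_and, false_or, Set.mem_ofPred_eq]
        rw [hα, Set.indicator_of_notMem hu]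
    rw [this]
    exact (hmeasS x).union (measurableSet_Ioo.compl.inter (MeasurableSet.const _))
  refine ⟨α, hmeas, ?_, ?_⟩
  · intro u hu v hv huv
    have := hF _ _ (hlt u hu v hv huv)
    rwa [hα1 u hu, hα1 v hv] at this
  · have : IsProbabilityMeasure (volume.restrict (Set.Ioo (0 : ℝ) 1)) := ⟨by simp⟩
    have : IsProbabilityMeasure (Measure.map α (volume.restrict (Set.Ioo (0 : ℝ) 1))) :=
      Measure.isProbabilityMeasure_map hmeas.aemeasurable
    refine Measure.eq_of_cdf _ _ ?_
    ext x
    rw [cdf_eq_real, measureReal_def, Measure.map_apply hmeas measurableSet_Iic,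
      Measure.restrict_apply (hmeas measurableSet_Iic)]
    have h0 := cdf_nonneg μ x
    have h1 := cdf_le_one μ x
    have l1 : volume (α ⁻¹' Set.Iic x ∩ Set.Ioo (0 : ℝ) 1) ≤ ENNReal.ofReal (cdf μ x) := by
      have : α ⁻¹' Set.Iic x ∩ Set.Ioo (0 : ℝ) 1 ⊆ Set.Ioc 0 (cdf μ x) := by
        intro u hu
        refine ⟨hu.2.1, ?_⟩
        rw [← hα1 u hu.2]
        exact hmono hu.1
      refine (measure_mono this).trans ?_
      simp
    have l2 : ENNReal.ofReal (cdf μ x) ≤ volume (α ⁻¹' Set.Iic x ∩ Set.Ioo (0 : ℝ) 1) := by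
      have : Set.Ioo 0 (cdf μ x) ⊆ α ⁻¹' Set.Iic x ∩ Set.Ioo (0 : ℝ) 1 := by
        intro u hu
        have hu' : u ∈ Set.Ioo (0 : ℝ) 1 := ⟨hu.1, hu.2.trans_le h1⟩
        refine ⟨?_, hu'⟩
        by_contra hcon
        have := hmono (not_le.1 hcon).le
        rw [hα1 u hu'] at this
        exact absurd hu.2 (not_lt.2 this)
      refine le_trans ?_ (measure_mono this)
      simp
    rw [le_antisymm l1 l2, ENNReal.toReal_ofReal h0]

/-- Stratified sampling: u = (v + i)/N. For fixed v the N nodes are 1/N apart, which the quantile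
function turns into gaps at least 1/(NM). -/
theorem intervalIntegral_eq_integral_average {h : ℝ → ℂ} (hh : IntervalIntegrable h volume 0 1)
    {N : ℕ} (hN : 0 < N) :
    ∫ u in (0 : ℝ)..1, h u =
      ∫ v in (0 : ℝ)..1, (N : ℂ)⁻¹ * ∑ i ∈ Finset.range N, h (v / N + i / N) := by
  have hN' : (N : ℝ) ≠ 0 := by positivity
  have hsub : ∀ i < N, IntervalIntegrable h volume ((i : ℝ) / N) (((i + 1 : ℕ) : ℝ) / N) := by
    intro i hi
    refine hh.mono_set ?_
    rw [Set.uIcc_of_le zero_le_one, Set.uIcc_of_le (by gcongr; simp)]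
    refine Set.Icc_subset_Icc (by positivity) ?_
    rw [div_le_one (by positivity)]
    exact_mod_cast hi
  have hcomp : ∀ i < N, IntervalIntegrable (fun v => h (v / N + i / N)) volume 0 1 := by
    intro i hi
    have h1 := (hsub i hi).comp_add_right ((i : ℝ) / N)
    have h2 := h1.comp_mul_right (c := (N : ℝ)⁻¹)
    have e : ∀ x : ℝ, x / N / (N : ℝ)⁻¹ = x := fun x => by field_simp
    have e1 : ((i : ℝ) / N - i / N) / (N : ℝ)⁻¹ = 0 := by simp
    have e2 : (((i + 1 : ℕ) : ℝ) / N - i / N) / (N : ℝ)⁻¹ = 1 := by push_cast; field_simp; ring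
    rw [e1, e2] at h2
    simpa [div_eq_mul_inv] using h2
  rw [intervalIntegral.integral_const_mul, intervalIntegral.integral_finsetSum
    fun i hi => hcomp i (Finset.mem_range.1 hi)]
  have h3 := intervalIntegral.sum_integral_adjacent_intervals (f := h) (μ := volume)
    (a := fun i : ℕ => (i : ℝ) / N) (n := N) hsub
  simp only [Nat.cast_zero, zero_div, div_self hN'] at h3
  rw [← h3, Finset.mul_sum]
  refine Finset.sum_congr rfl fun i _ => ?_
  rw [intervalIntegral.integral_comp_div_add _ hN']
  have e1 : (0 : ℝ) / N + i / N = i / N := by ring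
  have e2 : (1 : ℝ) / N + i / N = ((i + 1 : ℕ) : ℝ) / N := by push_cast; ring
  rw [e1, e2, Complex.real_smul]
  push_cast
  rw [← mul_assoc, inv_mul_cancel₀ (by exact_mod_cast hN'), one_mul]

/-- φ is the average over v of N-point exponential sums divided by N; Jensen moves the power inside,
and Fubini reduces the claim to the separated sums. -/
theorem integral_norm_charFun_pow_mul_gaussian_le {μ : Measure ℝ} [IsProbabilityMeasure μ] {M : ℝ}
    (hM : 0 < M) (hμ : μ ≤ ENNReal.ofReal M • (volume : Measure ℝ)) {b : ℝ} (hb : 0 < b) (k : ℕ)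
    {N : ℕ} (hN : 0 < N) :
    ∫ t, ‖charFun μ t‖ ^ (2 * k) * Real.exp (-b * t ^ 2) ≤
      (∫ y in (0 : ℝ)..Real.pi, sinRatio N y ^ (2 * k)) / Real.pi *
        (2 * √(Real.pi / b) + 2 * Real.pi * N * M) / N ^ (2 * k) := by
  obtain ⟨α, hα, hsep, hmap⟩ := exists_quantile hM hμ
  have hN0 : (0 : ℝ) < N := by positivity
  set ν : Measure ℝ := volume.restrict (Set.Ioo (0 : ℝ) 1) with hν
  have : IsProbabilityMeasure ν := ⟨by simp [hν]⟩
  set H : ℝ → ℝ → ℂ := fun v t =>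
    (N : ℂ)⁻¹ * seqExpSum (fun i => α (v / N + i / N), N) t with hH
  have hHm : Measurable (Function.uncurry H) := by
    simp only [hH, seqExpSum]
    unfold Function.uncurry
    fun_prop
  have hH1 : ∀ v t, ‖H v t‖ ≤ 1 := by
    intro v t
    simp only [hH, seqExpSum, norm_mul, norm_inv, Complex.norm_natCast]
    rw [inv_mul_le_iff₀ hN0, mul_one]
    refine (norm_sum_le _ _).trans ?_
    refine (Finset.sum_le_sum fun i _ => (Complex.norm_exp_ofReal_mul_I _).le).trans ?_
    simp
  have hg : ∀ t, charFun μ t = ∫ v, H v t ∂ν := by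
    intro t
    rw [charFun_apply_real, ← hmap, integral_map hα.aemeasurable (by fun_prop)]
    have hint : IntervalIntegrable (fun u => Complex.exp (t * (α u) * Complex.I)) volume 0 1 := by
      rw [intervalIntegrable_iff_integrableOn_Ioc_of_le zero_le_one]
      refine Measure.integrableOn_of_bounded (M := 1) (by simp) (by fun_prop) ?_
      filter_upwards with u
      rw [← Complex.ofReal_mul, Complex.norm_exp_ofReal_mul_I]
    have h1 := intervalIntegral_eq_integral_average hint hN
    rw [intervalIntegral.integral_of_le zero_le_one, intervalIntegral.integral_of_le zero_le_one,
      integral_Ioc_eq_integral_Ioo, integral_Ioc_eq_integral_Ioo] at h1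
    rw [h1]
    simp only [hH, seqExpSum]
    push_cast
    rfl
  have hJ : ∀ t, ‖charFun μ t‖ ^ (2 * k) ≤ ∫ v, ‖H v t‖ ^ (2 * k) ∂ν := by
    intro t
    have hHt : Measurable fun v => H v t := hHm.of_uncurry_right
    have i1 : Integrable (fun v => ‖H v t‖) ν := by
      refine Integrable.of_bound hHt.norm.aestronglyMeasurable 1 ?_
      filter_upwards with v
      simpa using hH1 v t
    have i2 : Integrable (fun v => ‖H v t‖ ^ (2 * k)) ν := by
      refine Integrable.of_bound (hHt.norm.pow_const _).aestronglyMeasurable 1 ?_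
      filter_upwards with v
      rw [norm_pow, norm_norm]
      exact pow_le_one₀ (norm_nonneg _) (hH1 v t)
    rw [hg]
    calc ‖∫ v, H v t ∂ν‖ ^ (2 * k) ≤ (∫ v, ‖H v t‖ ∂ν) ^ (2 * k) :=
          pow_le_pow_left₀ (norm_nonneg _) (norm_integral_le_integral_norm _) _
      _ ≤ ∫ v, ‖H v t‖ ^ (2 * k) ∂ν :=
          (convexOn_pow (2 * k)).map_integral_le (continuousOn_pow _) isClosed_Ici
            (Filter.Eventually.of_forall fun v => norm_nonneg _) i1 i2
  have hw := integrable_exp_neg_mul_sq hb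
  have hprod : Integrable (Function.uncurry fun v t => ‖H v t‖ ^ (2 * k) * Real.exp (-b * t ^ 2))
      (ν.prod volume) := by
    refine (hw.comp_snd ν).mono' ?_ ?_
    · have h1 : Measurable fun p : ℝ × ℝ => ‖H p.1 p.2‖ ^ (2 * k) := hHm.norm.pow_const _
      have h2 : Measurable fun p : ℝ × ℝ => Real.exp (-b * p.2 ^ 2) := by fun_prop
      exact (h1.mul h2).aestronglyMeasurable
    · filter_upwards with p
      simp only [Function.uncurry]
      rw [Real.norm_of_nonneg (by positivity)]
      exact mul_le_of_le_one_left (Real.exp_pos _).le (pow_le_one₀ (norm_nonneg _) (hH1 _ _))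
  have hstep : ∀ v ∈ Set.Ioo (0 : ℝ) 1, ∫ t, ‖H v t‖ ^ (2 * k) * Real.exp (-b * t ^ 2) ≤
      (∫ y in (0 : ℝ)..Real.pi, sinRatio N y ^ (2 * k)) / Real.pi *
        (2 * √(Real.pi / b) + 2 * Real.pi * N * M) / N ^ (2 * k) := by
    intro v hv
    have hs : IsSeparated (1 / (N * M)) (fun i => α (v / N + i / N), N) := by
      intro i hi
      simp only at hi ⊢
      have hi' : (i : ℝ) + 1 + 1 ≤ N := by exact_mod_cast hi
      have m1 : v / N + i / N ∈ Set.Ioo (0 : ℝ) 1 := by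
        have := hv.1
        refine ⟨by positivity, ?_⟩
        rw [← add_div, div_lt_one hN0]
        linarith [hv.2]
      have m2 : v / N + ((i + 1 : ℕ) : ℝ) / N ∈ Set.Ioo (0 : ℝ) 1 := by
        have := hv.1
        refine ⟨by positivity, ?_⟩
        rw [← add_div, div_lt_one hN0]
        push_cast
        linarith [hv.2]
      have := hsep _ m1 _ m2 (by gcongr; simp)
      have e : v / N + ((i + 1 : ℕ) : ℝ) / N - (v / N + i / N) = 1 / N := by
        push_cast; ring
      rw [e] at this
      have : 1 / (N * M) ≤ α (v / N + ((i + 1 : ℕ) : ℝ) / N) - α (v / N + i / N) := by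
        rw [← div_div, div_le_iff₀ hM]
        linarith
      linarith
    have h1 := integral_norm_seqExpSum_pow_mul_gaussian_le hb (by positivity) hs k
    have e : ∀ t, ‖H v t‖ ^ (2 * k) * Real.exp (-b * t ^ 2) = ((N : ℝ) ^ (2 * k))⁻¹ *
        (‖seqExpSum (fun i => α (v / N + i / N), N) t‖ ^ (2 * k) * Real.exp (-b * t ^ 2)) := by
      intro t
      simp only [hH, norm_mul, norm_inv, Complex.norm_natCast, mul_pow, inv_pow, mul_assoc]
    simp_rw [e]
    rw [integral_const_mul, mul_comm, ← div_eq_mul_inv]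
    gcongr
    refine h1.trans (le_of_eq ?_)
    field_simp
  calc ∫ t, ‖charFun μ t‖ ^ (2 * k) * Real.exp (-b * t ^ 2)
      ≤ ∫ t, ∫ v, ‖H v t‖ ^ (2 * k) * Real.exp (-b * t ^ 2) ∂ν := by
        refine integral_mono_of_nonneg (Filter.Eventually.of_forall fun t => by positivity)
          hprod.integral_prod_right (Filter.Eventually.of_forall fun t => ?_)
        simp only
        rw [integral_mul_const]
        exact mul_le_mul_of_nonneg_right (hJ t) (Real.exp_pos _).le
    _ = ∫ v, (∫ t, ‖H v t‖ ^ (2 * k) * Real.exp (-b * t ^ 2)) ∂ν :=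
        (integral_integral_swap hprod).symm
    _ ≤ ∫ v, (∫ y in (0 : ℝ)..Real.pi, sinRatio N y ^ (2 * k)) / Real.pi *
        (2 * √(Real.pi / b) + 2 * Real.pi * N * M) / N ^ (2 * k) ∂ν := by
        refine integral_mono_ae hprod.integral_prod_left (integrable_const _) ?_
        filter_upwards [ae_restrict_mem measurableSet_Ioo] with v hv
        exact hstep v hv
    _ = _ := by simp

open Filter Topology in
/-- Even moments of the characteristic function of a law with density at most `M`. -/
theorem integral_norm_charFun_pow_le {μ : Measure ℝ} [IsProbabilityMeasure μ] {M : ℝ}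
    (hM : 0 < M) (hμ : μ ≤ ENNReal.ofReal M • (volume : Measure ℝ)) {k : ℕ} {S : ℝ}
    (hS : Tendsto (fun N : ℕ => (∫ y in (0 : ℝ)..Real.pi, sinRatio N y ^ (2 * k)) / Real.pi * N /
      N ^ (2 * k)) atTop (𝓝 S)) :
    Integrable (fun t => ‖charFun μ t‖ ^ (2 * k)) ∧
      ∫ t, ‖charFun μ t‖ ^ (2 * k) ≤ 2 * Real.pi * M * S := by
  have hmeas : Measurable fun t => ‖charFun μ t‖ ^ (2 * k) := by fun_prop
  have hb : ∀ b, 0 < b → ∫ t, ‖charFun μ t‖ ^ (2 * k) * Real.exp (-b * t ^ 2) ≤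
      2 * Real.pi * M * S := by
    intro b hb
    -- For fixed `b`, the term 2√(π/b) is of order 1/N relative to 2πNM and disappears in the limit.
    have h1 : Tendsto (fun N : ℕ => (∫ y in (0 : ℝ)..Real.pi, sinRatio N y ^ (2 * k)) / Real.pi *
        N / N ^ (2 * k) * (2 * √(Real.pi / b) * ((N : ℝ))⁻¹ + 2 * Real.pi * M)) atTop
        (𝓝 (S * (2 * √(Real.pi / b) * 0 + 2 * Real.pi * M))) :=
      hS.mul ((tendsto_inv_atTop_nhds_zero_nat.const_mul _).add_const _)
    rw [show 2 * Real.pi * M * S = S * (2 * √(Real.pi / b) * 0 + 2 * Real.pi * M) by ring]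
    refine ge_of_tendsto h1 ?_
    filter_upwards [eventually_gt_atTop 0] with N hN
    refine (integral_norm_charFun_pow_mul_gaussian_le hM hμ hb k hN).trans (le_of_eq ?_)
    field_simp
  have hint : ∀ b, 0 < b → Integrable fun t => ‖charFun μ t‖ ^ (2 * k) * Real.exp (-b * t ^ 2) := by
    intro b hb
    refine (integrable_exp_neg_mul_sq hb).mono' (by fun_prop) ?_
    filter_upwards with t
    rw [Real.norm_of_nonneg (by positivity)]
    refine mul_le_of_le_one_left (Real.exp_pos _).le (pow_le_one₀ (norm_nonneg _) ?_)
    simpa using norm_charFun_le (μ := μ) t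
  have hlim : ∀ t, Tendsto (fun n : ℕ => ENNReal.ofReal
      (‖charFun μ t‖ ^ (2 * k) * Real.exp (-(1 / ((n : ℝ) + 1)) * t ^ 2))) atTop
      (𝓝 (ENNReal.ofReal (‖charFun μ t‖ ^ (2 * k)))) := by
    intro t
    refine ENNReal.tendsto_ofReal ?_
    have h1 : Tendsto (fun n : ℕ => -(1 / ((n : ℝ) + 1)) * t ^ 2) atTop (𝓝 (-0 * t ^ 2)) :=
      tendsto_one_div_add_atTop_nhds_zero_nat.neg.mul_const _
    have h2 := ((Real.continuous_exp.tendsto _).comp h1).const_mul (‖charFun μ t‖ ^ (2 * k))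
    simpa using h2
  -- Fatou's lemma removes the Gaussian weight, with b = 1/(n+1), and yields integrability as well.
  have hl : ∫⁻ t, ENNReal.ofReal (‖charFun μ t‖ ^ (2 * k)) ≤ ENNReal.ofReal (2 * Real.pi * M * S) := by
    calc ∫⁻ t, ENNReal.ofReal (‖charFun μ t‖ ^ (2 * k))
        = ∫⁻ t, liminf (fun n : ℕ => ENNReal.ofReal
            (‖charFun μ t‖ ^ (2 * k) * Real.exp (-(1 / ((n : ℝ) + 1)) * t ^ 2))) atTop := by
          simp_rw [fun t => (hlim t).liminf_eq]
      _ ≤ liminf (fun n : ℕ => ∫⁻ t, ENNReal.ofReal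
            (‖charFun μ t‖ ^ (2 * k) * Real.exp (-(1 / ((n : ℝ) + 1)) * t ^ 2))) atTop :=
          lintegral_liminf_le fun n => by fun_prop
      _ ≤ ENNReal.ofReal (2 * Real.pi * M * S) := by
          refine liminf_le_of_frequently_le' (Frequently.of_forall fun n => ?_)
          rw [← ofReal_integral_eq_lintegral_ofReal (hint _ (by positivity))
            (Eventually.of_forall fun t => by positivity)]
          exact ENNReal.ofReal_le_ofReal (hb _ (by positivity))
  have hI : Integrable fun t => ‖charFun μ t‖ ^ (2 * k) := by
    refine ⟨hmeas.aestronglyMeasurable, ?_⟩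
    rw [hasFiniteIntegral_iff_ofReal (Eventually.of_forall fun t => by positivity)]
    exact hl.trans_lt ENNReal.ofReal_lt_top
  refine ⟨hI, ?_⟩
  have hS0 : 0 ≤ 2 * Real.pi * M * S := by
    refine mul_nonneg (by positivity) (ge_of_tendsto' hS fun N => ?_)
    have : 0 ≤ ∫ y in (0 : ℝ)..Real.pi, sinRatio N y ^ (2 * k) :=
      intervalIntegral.integral_nonneg Real.pi_pos.le fun y _ => (even_two_mul k).pow_nonneg _
    positivity
  rw [integral_eq_lintegral_of_nonneg_ae (Eventually.of_forall fun t => by positivity)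
    hmeas.aestronglyMeasurable]
  exact ENNReal.toReal_le_of_le_ofReal hS0 hl

/-! ### Evaluating and estimating the moment constants. -/

theorem ae_sin_ne_zero_of_mem_uIoc :
    ∀ᵐ x : ℝ, x ∈ Set.uIoc 0 Real.pi → Real.sin x ≠ 0 := by
  have : ∀ᵐ x : ℝ, x ≠ Real.pi := by simp [ae_iff]
  filter_upwards [this] with x hx hx'
  rw [Set.uIoc_of_le Real.pi_pos.le] at hx'
  exact (Real.sin_pos_of_pos_of_lt_pi hx'.1 (lt_of_le_of_ne hx'.2 hx)).ne'

theorem sinRatio_mul_eq_sum (e m : ℕ) {x : ℝ} (hx : Real.sin x ≠ 0) :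
    sinRatio (m + 2 * e) x * sinRatio m x =
      ∑ r ∈ Finset.range m, sinRatio (2 * (r + e) + 1) x := by
  induction m with
  | zero => simp [sinRatio_zero]
  | succ m ih =>
    rw [Finset.sum_range_succ, ← ih, show m + 1 + 2 * e = (m + 2 * e) + 1 by ring,
      sinRatio_mul_succ _ _ hx, show m + 2 * e + m + 1 = 2 * (m + e) + 1 by ring, add_comm]

theorem integral_sinRatio_mul (e m : ℕ) :
    IntervalIntegrable (fun x => sinRatio (m + 2 * e) x * sinRatio m x) volume 0 Real.pi ∧
    ∫ x in (0 : ℝ)..Real.pi, sinRatio (m + 2 * e) x * sinRatio m x = Real.pi * m := by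
  have hae : ∀ᵐ x, x ∈ Set.uIoc 0 Real.pi →
      ∑ r ∈ Finset.range m, sinRatio (2 * (r + e) + 1) x =
        sinRatio (m + 2 * e) x * sinRatio m x := by
    filter_upwards [ae_sin_ne_zero_of_mem_uIoc] with x hx hx'
    exact (sinRatio_mul_eq_sum e m (hx hx')).symm
  refine ⟨?_, ?_⟩
  · refine (IntervalIntegrable.sum (Finset.range m)
      (fun r _ => (integral_sinRatio_odd (r + e)).1)).congr_ae ?_
    rw [Filter.EventuallyEq, ae_restrict_iff' measurableSet_uIoc]
    filter_upwards [hae] with x hx hx'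
    rw [← hx hx', Finset.sum_apply]
  · rw [← intervalIntegral.integral_congr_ae hae,
      intervalIntegral.integral_finsetSum fun r _ => (integral_sinRatio_odd (r + e)).1]
    simp_rw [fun r => (integral_sinRatio_odd r).2]
    simp [mul_comm]

theorem integral_sinRatio_sq (N : ℕ) :
    ∫ x in (0 : ℝ)..Real.pi, sinRatio N x ^ 2 = Real.pi * N := by
  have := (integral_sinRatio_mul 0 N).2
  simpa [sq] using this

theorem sum_min_range (N : ℕ) :
    ∑ i ∈ Finset.range N, ∑ j ∈ Finset.range N, (2 * (min i j : ℕ) + 1 : ℝ) =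
      (2 * N ^ 3 + N) / 3 := by
  induction N with
  | zero => simp
  | succ N ih =>
    have h1 : ∑ j ∈ Finset.range N, (2 * (min N j : ℕ) + 1 : ℝ) = N ^ 2 := by
      have : ∀ n : ℕ, ∑ j ∈ Finset.range n, (2 * (j : ℕ) + 1 : ℝ) = n ^ 2 := by
        intro n
        induction n with
        | zero => simp
        | succ n ih => rw [Finset.sum_range_succ, ih]; push_cast; ring
      rw [← this N]
      refine Finset.sum_congr rfl fun j hj => ?_
      rw [min_eq_right (Finset.mem_range.1 hj).le]
    rw [Finset.sum_range_succ]
    simp_rw [Finset.sum_range_succ _ N]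
    rw [Finset.sum_add_distrib, ih, h1]
    simp_rw [fun x : ℕ => min_comm x N]
    rw [h1, min_self]
    push_cast
    ring

/-- The square of the character is the sum of the odd characters of dimension below 2N, and a
product of two odd characters integrates to π times the smaller dimension. -/
theorem integral_sinRatio_pow_four (N : ℕ) :
    ∫ x in (0 : ℝ)..Real.pi, sinRatio N x ^ 4 = Real.pi * ((2 * N ^ 3 + N) / 3) := by
  have hpair : ∀ i j : ℕ,
      IntervalIntegrable (fun x => sinRatio (2 * i + 1) x * sinRatio (2 * j + 1) x) volume 0
        Real.pi ∧
      ∫ x in (0 : ℝ)..Real.pi, sinRatio (2 * i + 1) x * sinRatio (2 * j + 1) x =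
        Real.pi * (2 * (min i j : ℕ) + 1) := by
    intro i j
    wlog hij : j ≤ i generalizing i j
    · have := this j i (by omega)
      simp_rw [mul_comm (sinRatio (2 * i + 1) _), min_comm i j]
      exact this
    · have := integral_sinRatio_mul (i - j) (2 * j + 1)
      rw [show 2 * j + 1 + 2 * (i - j) = 2 * i + 1 by omega] at this
      rw [min_eq_right hij]
      push_cast at this
      exact this
  have hae : ∀ᵐ x, x ∈ Set.uIoc 0 Real.pi → sinRatio N x ^ 4 =
      ∑ i ∈ Finset.range N, ∑ j ∈ Finset.range N,
        sinRatio (2 * i + 1) x * sinRatio (2 * j + 1) x := by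
    filter_upwards [ae_sin_ne_zero_of_mem_uIoc] with x hx hx'
    have := sinRatio_mul_eq_sum 0 N (hx hx')
    simp only [mul_zero, add_zero] at this
    rw [← Finset.sum_mul_sum, ← this]
    ring
  have hrow : ∀ i, IntervalIntegrable (fun x => ∑ j ∈ Finset.range N,
      sinRatio (2 * i + 1) x * sinRatio (2 * j + 1) x) volume 0 Real.pi := fun i => by
    have := IntervalIntegrable.sum (Finset.range N) (fun j _ => (hpair i j).1)
    rwa [Finset.sum_fn] at this
  rw [intervalIntegral.integral_congr_ae hae, intervalIntegral.integral_finsetSum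
    fun i _ => hrow i]
  simp_rw [fun i => intervalIntegral.integral_finsetSum
    fun j (_ : j ∈ Finset.range N) => (hpair i j).1, fun i j => (hpair i j).2, ← Finset.mul_sum]
  rw [sum_min_range]

/-- Each factor of Euler's product satisfies 1 - x²/j² ≤ exp(-x²/j²), and ∑ 1/j² = π²/6. -/
theorem sin_le_mul_exp_neg_sq {u : ℝ} (h0 : 0 ≤ u) (h1 : u ≤ Real.pi) :
    Real.sin u ≤ u * Real.exp (-u ^ 2 / 6) := by
  set x := u / Real.pi with hx
  have hpi := Real.pi_pos
  have hux : u = Real.pi * x := by rw [hx]; field_simp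
  have hx0 : 0 ≤ x := by positivity
  have hx1 : x ≤ 1 := by rw [hx, div_le_one hpi]; exact h1
  have t1 := Real.tendsto_euler_sin_prod x
  rw [← hux] at t1
  have t2 : Filter.Tendsto (fun n : ℕ => u * Real.exp (-x ^ 2 *
      ∑ j ∈ Finset.range n, 1 / ((j : ℝ) + 1) ^ 2)) Filter.atTop
      (nhds (u * Real.exp (-x ^ 2 * (Real.pi ^ 2 / 6)))) := by
    have h2 : HasSum (fun n : ℕ => 1 / ((n : ℝ) + 1) ^ 2) (Real.pi ^ 2 / 6) := by
      have := (hasSum_nat_add_iff' 1).2 hasSum_zeta_two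
      simpa using this
    exact ((Real.continuous_exp.tendsto _).comp (h2.tendsto_sum_nat.const_mul _)).const_mul _
  have e : -u ^ 2 / 6 = -x ^ 2 * (Real.pi ^ 2 / 6) := by rw [hux]; ring
  rw [e]
  refine le_of_tendsto_of_tendsto' t1 t2 fun n => ?_
  refine mul_le_mul_of_nonneg_left ?_ h0
  rw [Finset.mul_sum, Real.exp_sum]
  refine Finset.prod_le_prod (fun j _ => ?_) (fun j _ => ?_)
  · rw [sub_nonneg, div_le_one (by positivity)]
    have : (0 : ℝ) ≤ j := by positivity
    gcongr
    linarith
  · have := Real.add_one_le_exp (-x ^ 2 * (1 / ((j : ℝ) + 1) ^ 2))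
    refine le_trans (le_of_eq ?_) this
    ring

theorem sinc_pow_le {k : ℕ} (u : ℝ) :
    Real.sinc u ^ (2 * k) ≤ Real.exp (-(k / 3) * u ^ 2) +
      (Set.Ioi Real.pi).indicator (fun x : ℝ => x ^ (-(2 * k : ℝ))) |u| := by
  wlog hu : 0 ≤ u generalizing u
  · have := this (-u) (by linarith)
    rwa [Real.sinc_neg, abs_neg, neg_sq] at this
  rw [abs_of_nonneg hu]
  rcases hu.eq_or_lt with rfl | hu
  · have : (0 : ℝ) ∉ Set.Ioi Real.pi := by simp [Real.pi_pos.le]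
    rw [Set.indicator_of_notMem this]
    simp
  rw [Real.sinc_of_ne_zero hu.ne']
  rcases le_or_gt u Real.pi with h | h
  · rw [Set.indicator_of_notMem (by simpa using h), add_zero]
    have h1 : Real.sin u / u ≤ Real.exp (-u ^ 2 / 6) := by
      rw [div_le_iff₀ hu, mul_comm]
      exact sin_le_mul_exp_neg_sq hu.le h
    have h2 : 0 ≤ Real.sin u / u := div_nonneg (Real.sin_nonneg_of_nonneg_of_le_pi hu.le h) hu.le
    refine (pow_le_pow_left₀ h2 h1 _).trans (le_of_eq ?_)
    rw [← Real.exp_nat_mul]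
    congr 1
    push_cast; ring
  · rw [Set.indicator_of_mem (by exact h)]
    have h1 : (Real.sin u / u) ^ (2 * k) ≤ u ^ (-(2 * k : ℝ)) := by
      rw [Real.rpow_neg hu.le, show (2 * k : ℝ) = ((2 * k : ℕ) : ℝ) by push_cast; rfl,
        Real.rpow_natCast, div_pow, div_eq_mul_inv]
      refine mul_le_of_le_one_left (by positivity) ?_
      rw [pow_mul]
      exact pow_le_one₀ (sq_nonneg _) (Real.sin_sq_le_one u)
    have := Real.exp_pos (-((k : ℝ) / 3) * u ^ 2)
    linarith

theorem integrable_sinc_pow {k : ℕ} (hk : 1 ≤ k) :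
    Integrable (fun u => Real.sinc u ^ (2 * k)) ∧
      ∫ u, Real.sinc u ^ (2 * k) ≤
        √(3 * Real.pi / k) + 2 * (Real.pi * (Real.pi ^ (2 * k))⁻¹ / (2 * k - 1)) := by
  have hk' : (1 : ℝ) ≤ k := by exact_mod_cast hk
  have hlt : (-(2 * k : ℝ)) < -1 := by linarith
  set φ := (Set.Ioi Real.pi).indicator (fun x : ℝ => x ^ (-(2 * k : ℝ))) with hφ
  have hI : IntegrableOn (fun x : ℝ => x ^ (-(2 * k : ℝ))) (Set.Ioi Real.pi) :=
    integrableOn_Ioi_rpow_of_lt hlt Real.pi_pos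
  have hφI : Integrable φ := hI.integrable_indicator measurableSet_Ioi
  have h1 : Integrable fun u => φ |u| := by
    have hneg : ∀ u ≤ 0, φ u = 0 := fun u hu =>
      Set.indicator_of_notMem (by simpa using hu.trans Real.pi_pos.le) _
    refine (hφI.add hφI.comp_neg).congr (Filter.Eventually.of_forall fun u => ?_)
    simp only [Pi.add_apply]
    rcases le_total 0 u with h | h
    · rw [abs_of_nonneg h, hneg (-u) (by linarith), add_zero]
    · rw [abs_of_nonpos h, hneg u h, zero_add]
  have h2 : Integrable fun u : ℝ => Real.exp (-((k : ℝ) / 3) * u ^ 2) :=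
    integrable_exp_neg_mul_sq (by positivity)
  have h3 : Integrable fun u => Real.sinc u ^ (2 * k) := by
    refine (h2.add h1).mono' (by fun_prop) ?_
    filter_upwards with u
    rw [Real.norm_of_nonneg ((even_two_mul k).pow_nonneg _)]
    exact sinc_pow_le u
  refine ⟨h3, (integral_mono h3 (h2.add h1) fun u => sinc_pow_le u).trans (le_of_eq ?_)⟩
  simp only [Pi.add_apply]
  rw [integral_add h2 h1, integral_gaussian, integral_comp_abs (f := φ)]
  have h4 : ∫ x in Set.Ioi 0, φ x = ∫ x in Set.Ioi Real.pi, x ^ (-(2 * k : ℝ)) := by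
    rw [hφ, setIntegral_indicator measurableSet_Ioi, Set.inter_eq_self_of_subset_right]
    exact Set.Ioi_subset_Ioi Real.pi_pos.le
  rw [h4, integral_Ioi_rpow_of_lt hlt Real.pi_pos]
  congr 1
  · congr 1
    field_simp
  · congr 1
    rw [Real.rpow_add Real.pi_pos, Real.rpow_one, Real.rpow_neg Real.pi_pos.le,
      show (2 * k : ℝ) = ((2 * k : ℕ) : ℝ) by push_cast; rfl, Real.rpow_natCast, neg_div,
      ← div_neg]
    congr 1
    · ring
    · push_cast; ring

-- Substitute y = u/N on one period centred at 0. The rescaled integrand tends to sinc^{2k}, and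
-- Jordan's inequality |sin x| ≥ 2|x|/π dominates it by (π/2)^{2k} sinc^{2k}.
open Filter Topology in
theorem tendsto_integral_sinRatio_pow {k : ℕ} (hk : 1 ≤ k) :
    Tendsto (fun N : ℕ => (∫ y in (0 : ℝ)..Real.pi, sinRatio N y ^ (2 * k)) / Real.pi * N /
      N ^ (2 * k)) atTop (𝓝 ((∫ u, Real.sinc u ^ (2 * k)) / Real.pi)) := by
  have hpi := Real.pi_pos
  set f : ℕ → ℝ → ℝ := fun N => (Set.Ioc (-(N * (Real.pi / 2))) (N * (Real.pi / 2))).indicator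
    (fun u => (sinRatio N (u / N) / N) ^ (2 * k)) with hf
  have hper : ∀ N : ℕ, Function.Periodic (fun y => sinRatio N y ^ (2 * k)) Real.pi := by
    intro N y
    simp only [sinRatio]
    rw [mul_add, Real.sin_add_nat_mul_pi, Real.sin_add_pi, div_neg, neg_pow, pow_mul (-1 : ℝ),
      mul_div_assoc, mul_pow, ← pow_mul (-1 : ℝ) N, mul_comm N, mul_assoc, pow_mul (-1 : ℝ) 2]
    simp
  have heq : ∀ N : ℕ, 0 < N → ∫ u, f N u = (∫ y in (0 : ℝ)..Real.pi, sinRatio N y ^ (2 * k)) * N /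
      N ^ (2 * k) := by
    intro N hN
    have hN' : (N : ℝ) ≠ 0 := by positivity
    rw [hf, integral_indicator measurableSet_Ioc, ← intervalIntegral.integral_of_le
      (by have : 0 ≤ N * (Real.pi / 2) := by positivity
          linarith)]
    simp_rw [div_pow]
    rw [intervalIntegral.integral_div, intervalIntegral.integral_comp_div
      (fun y => sinRatio N y ^ (2 * k)) hN']
    have e := (hper N).intervalIntegral_add_eq (-(Real.pi / 2)) 0
    rw [show -(Real.pi / 2) + Real.pi = Real.pi / 2 by ring, zero_add] at e
    rw [show -(N * (Real.pi / 2)) / (N : ℝ) = -(Real.pi / 2) by field_simp,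
      show (N * (Real.pi / 2)) / (N : ℝ) = Real.pi / 2 by field_simp, e, smul_eq_mul]
    ring
  have hlim : Tendsto (fun N : ℕ => ∫ u, f N u) atTop (𝓝 (∫ u, Real.sinc u ^ (2 * k))) := by
    refine tendsto_integral_of_dominated_convergence
      (fun u => (Real.pi / 2) ^ (2 * k) * Real.sinc u ^ (2 * k)) ?_
      ((integrable_sinc_pow hk).1.const_mul _) ?_ ?_
    · intro N
      refine (Measurable.indicator ?_ measurableSet_Ioc).aestronglyMeasurable
      unfold sinRatio
      fun_prop
    · intro N
      filter_upwards with u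
      have hnn : 0 ≤ (Real.pi / 2) ^ (2 * k) * Real.sinc u ^ (2 * k) :=
        mul_nonneg (by positivity) ((even_two_mul k).pow_nonneg _)
      by_cases hu : u ∈ Set.Ioc (-(N * (Real.pi / 2))) (N * (Real.pi / 2))
      · rw [hf]
        simp only
        rw [Set.indicator_of_mem hu, Real.norm_of_nonneg ((even_two_mul k).pow_nonneg _)]
        rw [← mul_pow, ← (even_two_mul k).pow_abs, ← (even_two_mul k).pow_abs (_ * _)]
        refine pow_le_pow_left₀ (abs_nonneg _) ?_ _
        rcases eq_or_ne u 0 with rfl | hu0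
        · simp [sinRatio]
        rcases Nat.eq_zero_or_pos N with rfl | hN
        · simp [sinRatio_zero]
        have hN' : (0 : ℝ) < N := by positivity
        have h1 : |u / N| ≤ Real.pi / 2 := by
          rw [abs_div, abs_of_pos hN', div_le_iff₀ hN', abs_le]
          constructor <;> linarith [hu.1, hu.2]
        have h2 := Real.mul_abs_le_abs_sin h1
        have h3 : 0 < |u| := abs_pos.2 hu0
        unfold sinRatio
        rw [Real.sinc_of_ne_zero hu0, mul_div_cancel₀ _ hN'.ne', abs_mul,
          abs_of_pos (by positivity : 0 < Real.pi / 2), abs_div, abs_div, abs_div, abs_of_pos hN',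
          div_div]
        have h4 : 2 / Real.pi * |u| ≤ |Real.sin (u / N)| * N := by
          rw [abs_div, abs_of_pos hN'] at h2
          calc 2 / Real.pi * |u| = 2 / Real.pi * (|u| / N) * N := by field_simp
            _ ≤ _ := by gcongr
        calc |Real.sin u| / (|Real.sin (u / N)| * N) ≤ |Real.sin u| / (2 / Real.pi * |u|) := by
              gcongr
          _ = _ := by field_simp
      · rw [hf]
        simp only
        rw [Set.indicator_of_notMem hu]
        simpa using hnn
    · have hne : ∀ᵐ u : ℝ, u ≠ 0 := by simp [ae_iff]
      filter_upwards [hne] with u hu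
      have h1 : Tendsto (fun N : ℕ => u / (N : ℝ)) atTop (𝓝 0) :=
        tendsto_const_div_atTop_nhds_zero_nat u
      have h2 : Tendsto (fun N : ℕ => Real.sinc (u / N)) atTop (𝓝 1) := by
        have := (Real.continuous_sinc.tendsto 0).comp h1
        rwa [Real.sinc_zero] at this
      have h3 : Tendsto (fun N : ℕ => (Real.sinc u / Real.sinc (u / N)) ^ (2 * k)) atTop
          (𝓝 ((Real.sinc u / 1) ^ (2 * k))) :=
        (tendsto_const_nhds.div h2 one_ne_zero).pow _
      rw [div_one] at h3
      refine h3.congr' ?_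
      have h4 : ∀ᶠ N : ℕ in atTop, |u| < N * (Real.pi / 2) := by
        have : Tendsto (fun N : ℕ => (N : ℝ) * (Real.pi / 2)) atTop atTop :=
          tendsto_natCast_atTop_atTop.atTop_mul_const (by positivity)
        exact this.eventually_gt_atTop _
      filter_upwards [h4, eventually_gt_atTop 0] with N hN hN0
      have hN' : (N : ℝ) ≠ 0 := by positivity
      have hmem : u ∈ Set.Ioc (-(N * (Real.pi / 2))) (N * (Real.pi / 2)) := by
        have := abs_lt.1 hN
        exact ⟨this.1, this.2.le⟩
      rw [hf]
      simp only
      rw [Set.indicator_of_mem hmem, Real.sinc_of_ne_zero hu,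
        Real.sinc_of_ne_zero (div_ne_zero hu hN'), sinRatio, mul_div_cancel₀ _ hN']
      congr 1
      field_simp
  refine (hlim.div_const Real.pi).congr' ?_
  filter_upwards [eventually_gt_atTop 0] with N hN
  rw [heq N hN]
  ring

theorem integral_sinc_pow_div_pi_le {k : ℕ} (hk : 3 ≤ k) :
    (∫ u, Real.sinc u ^ (2 * k)) / Real.pi ≤ 0.978 / √k := by
  have hk' : (3 : ℝ) ≤ k := by exact_mod_cast hk
  -- The Gaussian part gives √(3/π) < 0.97721; the part beyond π adds less than 0.0008 because π^6 >
  -- 961. Together they stay below 0.978.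
  have hpi := Real.pi_gt_d6
  have hsk : 0 < √(k : ℝ) := Real.sqrt_pos.2 (by linarith)
  have h1 := (integrable_sinc_pow (k := k) (by omega)).2
  have e1 : √(3 * Real.pi / k) ≤ 0.97721 * Real.pi / √k := by
    rw [Real.sqrt_div (by positivity)]
    gcongr
    refine Real.sqrt_le_iff.2 ⟨by positivity, ?_⟩
    nlinarith
  have e2 : (Real.pi ^ (2 * k))⁻¹ ≤ 1 / 961 := by
    rw [inv_eq_one_div]
    refine one_div_le_one_div_of_le (by norm_num) ?_
    calc (961 : ℝ) ≤ 3.1415 ^ 6 := by norm_num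
      _ ≤ Real.pi ^ 6 := by gcongr; linarith
      _ ≤ Real.pi ^ (2 * k) := pow_le_pow_right₀ (by linarith) (by omega)
  have e3 : 1 / (2 * (k : ℝ) - 1) ≤ 0.3465 / √k := by
    rw [div_le_div_iff₀ (by linarith) hsk, one_mul]
    refine Real.sqrt_le_iff.2 ⟨by nlinarith, ?_⟩
    nlinarith
  have e4 : Real.pi * (Real.pi ^ (2 * k))⁻¹ / (2 * k - 1) ≤
      Real.pi * (1 / 961) * (0.3465 / √k) := by
    rw [div_eq_mul_one_div]
    have : 0 ≤ 1 / (2 * (k : ℝ) - 1) := one_div_nonneg.2 (by linarith)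
    gcongr
  rw [div_le_iff₀ Real.pi_pos]
  refine h1.trans ?_
  have h3 : 0.97721 * Real.pi / √k + 2 * (Real.pi * (1 / 961) * (0.3465 / √k)) ≤
      0.978 / √k * Real.pi := by
    have : 0 < Real.pi / √k := by positivity
    have a1 : 0.97721 * Real.pi / √k = 0.97721 * (Real.pi / √k) := by ring
    have a2 : 2 * (Real.pi * (1 / 961) * (0.3465 / √k)) = 2 * (1/961) * 0.3465 * (Real.pi / √k) := by
      ring
    have a3 : 0.978 / √k * Real.pi = 0.978 * (Real.pi / √k) := by ring
    rw [a1, a2, a3]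
    nlinarith
  linarith

/-- An upper bound for the `2k`-th moment of the characteristic function of a law with density at
most `M`, relative to `2 π M`. -/
noncomputable def evenMomentBound (k : ℕ) : ℝ :=
  if k = 1 then 1 else if k = 2 then 2 / 3 else 0.978 / √k

open Filter Topology in
theorem integral_norm_charFun_pow_le_evenMomentBound {μ : Measure ℝ} [IsProbabilityMeasure μ]
    {M : ℝ} (hM : 0 < M) (hμ : μ ≤ ENNReal.ofReal M • (volume : Measure ℝ)) {k : ℕ} (hk : 1 ≤ k) :
    Integrable (fun t => ‖charFun μ t‖ ^ (2 * k)) ∧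
      ∫ t, ‖charFun μ t‖ ^ (2 * k) ≤ 2 * Real.pi * M * evenMomentBound k := by
  have hpi := Real.pi_pos
  rcases (by omega : k = 1 ∨ k = 2 ∨ 3 ≤ k) with rfl | rfl | hk3
  · refine integral_norm_charFun_pow_le hM hμ ?_
    simp only [evenMomentBound, if_true]
    refine tendsto_const_nhds.congr' ?_
    filter_upwards [eventually_gt_atTop 0] with N hN
    rw [mul_one, integral_sinRatio_sq]
    field_simp
  · refine integral_norm_charFun_pow_le hM hμ ?_
    have : evenMomentBound 2 = (2 + 0) / 3 := by norm_num [evenMomentBound]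
    rw [this]
    have h0 : Tendsto (fun N : ℕ => ((N : ℝ) ^ 2)⁻¹) atTop (𝓝 0) :=
      ((tendsto_pow_atTop two_ne_zero).comp tendsto_natCast_atTop_atTop).inv_tendsto_atTop
    refine ((h0.const_add 2).div_const 3).congr' ?_
    filter_upwards [eventually_gt_atTop 0] with N hN
    rw [show 2 * 2 = 4 by rfl, integral_sinRatio_pow_four]
    field_simp
  · obtain ⟨h1, h2⟩ := integral_norm_charFun_pow_le hM hμ (tendsto_integral_sinRatio_pow hk)
    refine ⟨h1, h2.trans ?_⟩
    have : evenMomentBound k = 0.978 / √k := by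
      rw [evenMomentBound, if_neg (by omega), if_neg (by omega)]
    rw [this]
    have := integral_sinc_pow_div_pi_le hk3
    gcongr

/-! ### Pointwise decay of the characteristic function. -/

/-- By cos y ≤ 1 - 2y²/π² the integrand lies below the truncated parabola (2/π²)(c² - y²)₊, whose
integral over the line is the right side. -/
theorem integral_max_sub_one_sub_cos_le {c : ℝ} (hc : 0 ≤ c) :
    ∫ y in (-Real.pi)..Real.pi, max (2 * c ^ 2 / Real.pi ^ 2 - (1 - Real.cos y)) 0 ≤
      8 * c ^ 3 / (3 * Real.pi ^ 2) := by
  have hpi := Real.pi_pos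
  set h : ℝ → ℝ := (Set.Ioc (-c) c).indicator fun y => 2 / Real.pi ^ 2 * (c ^ 2 - y ^ 2) with hh
  have hI : IntegrableOn (fun y : ℝ => 2 / Real.pi ^ 2 * (c ^ 2 - y ^ 2)) (Set.Ioc (-c) c) :=
    (Continuous.integrableOn_Icc (by fun_prop)).mono_set Set.Ioc_subset_Icc_self
  have hint : Integrable h := hI.integrable_indicator measurableSet_Ioc
  have hnn : ∀ y, 0 ≤ h y := by
    intro y
    refine Set.indicator_nonneg (fun y hy => ?_) y
    have : 0 ≤ c ^ 2 - y ^ 2 := by nlinarith [hy.1, hy.2]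
    positivity
  have hle : ∀ y ∈ Set.Icc (-Real.pi) Real.pi, y ≠ -c →
      max (2 * c ^ 2 / Real.pi ^ 2 - (1 - Real.cos y)) 0 ≤ h y := by
    intro y hy hyc
    refine max_le ?_ (hnn y)
    have h1 := Real.cos_le_one_sub_mul_cos_sq (abs_le.2 hy)
    have h2 : 2 * c ^ 2 / Real.pi ^ 2 - (1 - Real.cos y) ≤ 2 / Real.pi ^ 2 * (c ^ 2 - y ^ 2) := by
      have : 2 * c ^ 2 / Real.pi ^ 2 = 2 / Real.pi ^ 2 * c ^ 2 := by ring
      rw [this]; linarith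
    by_cases hm : y ∈ Set.Ioc (-c) c
    · rw [hh, Set.indicator_of_mem hm]; exact h2
    · rw [hh, Set.indicator_of_notMem hm]
      refine h2.trans ?_
      have : c ^ 2 ≤ y ^ 2 := by
        rw [Set.mem_Ioc, not_and_or, not_lt, not_le] at hm
        rcases hm with hm | hm <;> nlinarith
      exact mul_nonpos_of_nonneg_of_nonpos (by positivity) (by linarith)
  have hne : ∀ᵐ y : ℝ, y ≠ -c := by simp [ae_iff]
  calc ∫ y in (-Real.pi)..Real.pi, max (2 * c ^ 2 / Real.pi ^ 2 - (1 - Real.cos y)) 0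
      ≤ ∫ y in (-Real.pi)..Real.pi, h y := by
        refine intervalIntegral.integral_mono_ae_restrict (by linarith)
          (Continuous.intervalIntegrable (by fun_prop) _ _) hint.intervalIntegrable ?_
        filter_upwards [ae_restrict_mem measurableSet_Icc, ae_restrict_of_ae hne] with y hy hy'
        exact hle y hy hy'
    _ ≤ ∫ y, h y := by
        rw [intervalIntegral.integral_of_le (by linarith)]
        exact setIntegral_le_integral hint (Filter.Eventually.of_forall hnn)
    _ = 8 * c ^ 3 / (3 * Real.pi ^ 2) := by
        rw [hh, integral_indicator measurableSet_Ioc,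
          ← intervalIntegral.integral_of_le (by linarith), intervalIntegral.integral_const_mul,
          intervalIntegral.integral_sub (by simp) (Continuous.intervalIntegrable (by fun_prop) _ _)]
        rw [intervalIntegral.integral_const, integral_pow]
        simp only [smul_eq_mul]
        field_simp
        norm_num
        ring

/-- After rotating by the argument of φ(u), 1 - |φ(u)| is the mean of 1 - cos(ux - φ₀). Chebyshev
puts mass at least 1 - 1/R² within R of the mean, and the density bound limits how much of it can
sit where the cosine is near 1. The condition on R u makes the window exactly j periods. -/
theorem norm_charFun_le_one_sub {μ : Measure ℝ} [IsProbabilityMeasure μ] {M : ℝ} (hM : 0 < M)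
    (hμ : μ ≤ ENNReal.ofReal M • (volume : Measure ℝ)) (hL : MemLp id 2 μ) (hV : Var[id; μ] = 1)
    {u : ℝ} (hu : 0 < u) {j : ℕ} {R : ℝ} (hR : 1 < R) (hRj : R * u = j * Real.pi) :
    ‖charFun μ u‖ ≤ 1 - (1 - 1 / R ^ 2) ^ 3 / (6 * R ^ 2 * M ^ 2) := by
  have hpi := Real.pi_pos
  have hR0 : 0 < R := by linarith
  set m := ∫ x, id x ∂μ with hm
  set m0 := 1 - 1 / R ^ 2 with hm0
  have hm0' : 0 ≤ m0 := by
    rw [hm0, sub_nonneg, div_le_one (by positivity)]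
    nlinarith
  set I := Set.Ioc (m - R) (m + R) with hI
  have hPI : m0 ≤ μ.real I := by
    have h1 := meas_ge_le_variance_div_sq hL hR0
    rw [hV] at h1
    have h2 : Iᶜ ⊆ {ω | R ≤ |id ω - ∫ x, id x ∂μ|} := by
      intro x hx
      rw [Set.mem_compl_iff, hI, Set.mem_Ioc, not_and_or, not_lt, not_le] at hx
      rw [Set.mem_ofPred_eq, ← hm, id]
      rcases hx with hx | hx
      · rw [abs_sub_comm]; exact (by linarith : R ≤ m - x).trans (le_abs_self _)
      · exact (by linarith : R ≤ x - m).trans (le_abs_self _)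
    have h3 : μ.real Iᶜ ≤ 1 / R ^ 2 :=
      ENNReal.toReal_le_of_le_ofReal (by positivity) ((measure_mono h2).trans h1)
    rw [probReal_compl_eq_one_sub measurableSet_Ioc] at h3
    rw [hm0]; linarith
  set φ := Complex.arg (charFun μ u) with hφ
  have hcosI : Integrable (fun x => Real.cos (u * x - φ)) μ := by
    refine Integrable.of_bound (by fun_prop) 1 (Filter.Eventually.of_forall fun x => ?_)
    exact Real.abs_cos_le_one _
  have hnorm : ‖charFun μ u‖ = ∫ x, Real.cos (u * x - φ) ∂μ := by
    have h1 : (‖charFun μ u‖ : ℂ) = ∫ x, Complex.exp (((u * x - φ : ℝ) : ℂ) * Complex.I) ∂μ := by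
      have h2 := Complex.norm_mul_exp_arg_mul_I (charFun μ u)
      rw [← hφ] at h2
      have h3 : (‖charFun μ u‖ : ℂ) = charFun μ u * Complex.exp (-(φ * Complex.I)) := by
        rw [← h2, mul_assoc, ← Complex.exp_add, add_neg_cancel, Complex.exp_zero, mul_one, h2]
      rw [h3, charFun_apply_real, ← integral_mul_const]
      congr 1
      ext x
      rw [← Complex.exp_add]
      congr 1
      push_cast; ring
    have h4 := congrArg Complex.re h1
    rw [Complex.ofReal_re] at h4
    rw [h4, ← RCLike.re_eq_complex_re, ← integral_re]
    · congr 1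
      ext x
      exact Complex.exp_ofReal_mul_I_re _
    · refine Integrable.of_bound (by fun_prop) 1 (Filter.Eventually.of_forall fun x => ?_)
      rw [Complex.norm_exp_ofReal_mul_I]
  -- This `c` maximizes the lower bound l·m0 - 8MRc³/(3π³) with l = 2c²/π².
  set c := Real.pi * m0 / (2 * R * M) with hc
  have hc0 : 0 ≤ c := by positivity
  set l := 2 * c ^ 2 / Real.pi ^ 2 with hl
  set p : ℝ → ℝ := fun x => max (l - (1 - Real.cos (u * x - φ))) 0 with hp
  have hpc : Continuous p := by fun_prop
  have hpb : ∀ x, ‖p x‖ ≤ l := by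
    intro x
    rw [Real.norm_of_nonneg (le_max_right _ _)]
    refine max_le ?_ (by positivity)
    linarith [Real.cos_le_one (u * x - φ)]
  have hpI : Integrable p μ := Integrable.of_bound (by fun_prop) l (Filter.Eventually.of_forall hpb)
  have hvol : ∫ x in I, p x ≤ R / Real.pi * (8 * c ^ 3 / (3 * Real.pi ^ 2)) := by
    set q : ℝ → ℝ := fun y => max (l - (1 - Real.cos y)) 0 with hq
    have hqc : Continuous q := by fun_prop
    have hper : Function.Periodic q (2 * Real.pi) := by
      intro y
      simp only [hq, Real.cos_add_two_pi]
    rw [hI, ← intervalIntegral.integral_of_le (by linarith)]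
    have e1 : ∫ x in (m - R)..(m + R), p x = u⁻¹ • ∫ y in (u * (m - R) - φ)..(u * (m + R) - φ), q y :=
      intervalIntegral.integral_comp_mul_sub q hu.ne' φ
    have e2 : u * (m + R) - φ = (u * (m - R) - φ) + (j : ℤ) • (2 * Real.pi) := by
      simp only [natCast_zsmul, nsmul_eq_mul]
      linear_combination 2 * hRj
    rw [e1, e2, hper.intervalIntegral_add_zsmul_eq (j : ℤ) _
      fun a b => hqc.intervalIntegrable a b]
    have e3 := hper.intervalIntegral_add_eq (u * (m - R) - φ) (-Real.pi)
    rw [show -Real.pi + 2 * Real.pi = Real.pi by ring] at e3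
    have e4 := integral_max_sub_one_sub_cos_le hc0
    rw [e3]
    simp only [natCast_zsmul, nsmul_eq_mul, smul_eq_mul]
    have e5 : u⁻¹ * (j * ∫ y in (-Real.pi)..Real.pi, q y) =
        R / Real.pi * ∫ y in (-Real.pi)..Real.pi, q y := by
      have : (j : ℝ) = R * u / Real.pi := by rw [hRj]; field_simp
      rw [this]; field_simp
    rw [e5]
    exact mul_le_mul_of_nonneg_left e4 (by positivity)
  have hmuI : ∫ x in I, p x ∂μ ≤ M * ∫ x in I, p x := by
    have h1 : μ.restrict I ≤ ENNReal.ofReal M • (volume : Measure ℝ).restrict I := by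
      rw [← Measure.restrict_smul]
      exact Measure.restrict_mono_measure hμ I
    have h2 : Integrable p ((volume : Measure ℝ).restrict I) :=
      Measure.integrableOn_of_bounded (M := l) (by simp [hI]) (by fun_prop)
        (Filter.Eventually.of_forall hpb)
    have h3 := integral_mono_measure h1 (Filter.Eventually.of_forall fun x => le_max_right _ _)
      (h2.smul_measure ENNReal.ofReal_ne_top)
    rwa [integral_smul_measure, ENNReal.toReal_ofReal hM.le, smul_eq_mul] at h3
  have hlow : l * m0 - M * (R / Real.pi * (8 * c ^ 3 / (3 * Real.pi ^ 2))) ≤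
      ∫ x, (1 - Real.cos (u * x - φ)) ∂μ := by
    have hψ : Integrable (fun x => 1 - Real.cos (u * x - φ)) μ := (integrable_const 1).sub hcosI
    have h1 : ∫ x in I, (1 - Real.cos (u * x - φ)) ∂μ ≤ ∫ x, (1 - Real.cos (u * x - φ)) ∂μ :=
      setIntegral_le_integral hψ (Filter.Eventually.of_forall fun x => by
        simpa using Real.cos_le_one (u * x - φ))
    have h2 : ∫ x in I, (l - p x) ∂μ ≤ ∫ x in I, (1 - Real.cos (u * x - φ)) ∂μ := by
      refine integral_mono ((integrable_const l).sub hpI.integrableOn) hψ.integrableOn fun x => ?_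
      have := le_max_left (l - (1 - Real.cos (u * x - φ))) 0
      simp only [hp]; linarith
    rw [integral_sub (integrable_const l) hpI.integrableOn, setIntegral_const, smul_eq_mul] at h2
    have h3 : l * m0 ≤ μ.real I * l := by
      rw [mul_comm]; exact mul_le_mul_of_nonneg_right hPI (by positivity)
    have h4 := mul_le_mul_of_nonneg_left hvol hM.le
    linarith
  rw [integral_sub (integrable_const 1) hcosI, ← hnorm] at hlow
  have e : l * m0 - M * (R / Real.pi * (8 * c ^ 3 / (3 * Real.pi ^ 2))) =
      m0 ^ 3 / (6 * R ^ 2 * M ^ 2) := by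
    rw [hl, hc]
    field_simp
    ring
  rw [e] at hlow
  simp at hlow
  linarith

theorem norm_charFun_le_exp {μ : Measure ℝ} [IsProbabilityMeasure μ] {M : ℝ} (hM : 0 < M)
    (hμ : μ ≤ ENNReal.ofReal M • (volume : Measure ℝ)) (hL : MemLp id 2 μ) (hV : Var[id; μ] = 1)
    {ε : ℝ} (hε : 0 < ε) (hε1 : ε ≤ 1) {u : ℝ} (hu : ε ≤ |u|) :
    ‖charFun μ u‖ ≤ Real.exp (-(ε ^ 2 / (85 * M ^ 2))) := by
  wlog hpos : 0 ≤ u generalizing u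
  · have := this (u := -u) (by rwa [abs_neg]) (by linarith)
    rwa [charFun_neg, RCLike.norm_conj] at this
  rw [abs_of_nonneg hpos] at hu
  have hu0 : 0 < u := by linarith
  have hpi := Real.pi_gt_d4
  have hpi2 := Real.pi_lt_d4
  suffices h : ∃ (j : ℕ) (R : ℝ), 1 < R ∧ R * u = j * Real.pi ∧
      ε ^ 2 / 85 ≤ (1 - 1 / R ^ 2) ^ 3 / (6 * R ^ 2) by
    obtain ⟨j, R, hR, hRj, hle⟩ := h
    have h1 := norm_charFun_le_one_sub hM hμ hL hV hu0 hR hRj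
    have h2 := Real.add_one_le_exp (-(ε ^ 2 / (85 * M ^ 2)))
    have h3 : ε ^ 2 / (85 * M ^ 2) ≤ (1 - 1 / R ^ 2) ^ 3 / (6 * R ^ 2 * M ^ 2) := by
      rw [← div_div, ← div_div]
      gcongr
    linarith
  have key : ∀ R : ℝ, 1 < R → (1 - 1 / R ^ 2) ^ 3 / (6 * R ^ 2) =
      (R ^ 2 - 1) ^ 3 / (6 * (R ^ 2) ^ 4) := by
    intro R hR
    have : R ≠ 0 := by linarith
    field_simp
  -- For small u one period suffices, with R = π/u ≥ 3; the constant is 6π²/(8/9)³ < 85.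
  rcases le_or_gt u (Real.pi / 3) with h | h
  · refine ⟨1, Real.pi / u, ?_, ?_, ?_⟩
    · rw [lt_div_iff₀ hu0]; linarith
    · field_simp; simp
    · have hR3 : 3 ≤ Real.pi / u := by rw [le_div_iff₀ hu0]; linarith
      have e : (1 - 1 / (Real.pi / u) ^ 2) ^ 3 / (6 * (Real.pi / u) ^ 2) =
          (1 - 1 / (Real.pi / u) ^ 2) ^ 3 * (u ^ 2 / (6 * Real.pi ^ 2)) := by
        field_simp
      rw [e]
      have h1 : (8 / 9 : ℝ) ≤ 1 - 1 / (Real.pi / u) ^ 2 := by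
        have : 1 / (Real.pi / u) ^ 2 ≤ 1 / 3 ^ 2 := by gcongr
        linarith
      have h2 : (8 / 9 : ℝ) ^ 3 ≤ (1 - 1 / (Real.pi / u) ^ 2) ^ 3 := by gcongr
      have h4 : ε ^ 2 ≤ u ^ 2 := by gcongr
      calc ε ^ 2 / 85 ≤ (8 / 9 : ℝ) ^ 3 * (u ^ 2 / 59.3) := by
            have := sq_nonneg u
            norm_num
            linarith
        _ ≤ _ := by
          gcongr
          nlinarith
  · set j := ⌊3 * u / Real.pi⌋₊ with hj
    have hj1 : 1 ≤ j := by
      rw [hj, Nat.one_le_floor_iff, le_div_iff₀ (by linarith)]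
      linarith
    have hj1' : (1 : ℝ) ≤ j := by exact_mod_cast hj1
    have hjle : (j : ℝ) * Real.pi ≤ 3 * u := by
      have := Nat.floor_le (show 0 ≤ 3 * u / Real.pi by positivity)
      rwa [← hj, le_div_iff₀ (by linarith)] at this
    have hjlt : 3 * u < (j + 1) * Real.pi := by
      have := Nat.lt_floor_add_one (3 * u / Real.pi)
      rwa [← hj, div_lt_iff₀ (by linarith)] at this
    have hR1 : 3 / 2 ≤ j * Real.pi / u := by
      rw [le_div_iff₀ hu0]
      nlinarith
    have hR2 : j * Real.pi / u ≤ 3 := by rwa [div_le_iff₀ hu0]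
    refine ⟨j, j * Real.pi / u, by linarith, by field_simp, ?_⟩
    rw [key _ (by linarith)]
    set r := (j * Real.pi / u) ^ 2 with hr
    have hr1 : 9 / 4 ≤ r := by nlinarith
    have hr2 : r ≤ 9 := by nlinarith
    have h1 : ε ^ 2 / 85 ≤ 1 / 85 := by
      gcongr
      nlinarith
    refine h1.trans ?_
    rw [div_le_div_iff₀ (by norm_num) (by positivity)]
    have hs : 0 ≤ r - 9 / 4 := by linarith
    have ht : 0 ≤ 9 - r := by linarith
    -- The quartic inequality in `r` is read off from its Bernstein coefficients on [9/4, 9].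
    linarith [pow_nonneg hs 4, mul_nonneg (pow_nonneg hs 3) ht,
      mul_nonneg (pow_nonneg hs 2) (pow_nonneg ht 2), mul_nonneg hs (pow_nonneg ht 3),
      pow_nonneg ht 4]

/-! ### Interpolation to real exponents. -/

theorem log_one_add_le_of_nonneg {x : ℝ} (hx : 0 ≤ x) :
    Real.log (1 + x) ≤ x * (x + 2) / (2 * (1 + x)) := by
  let f : ℝ → ℝ := fun x => (1 + x) / 2 - (1 + x)⁻¹ / 2 - Real.log (1 + x)
  have hd : ∀ y ∈ Set.Ici (0 : ℝ), HasDerivAt f (1 / 2 - -1 / (1 + y) ^ 2 / 2 - 1 / (1 + y)) y := by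
    intro y hy
    have hy' : 1 + y ≠ 0 := by have : (0 : ℝ) ≤ y := hy; positivity
    have h1 : HasDerivAt (fun x : ℝ => 1 + x) 1 y := (hasDerivAt_id y).const_add 1
    exact ((h1.div_const 2).sub ((h1.inv hy').div_const 2)).sub (h1.log hy')
  have hmono : MonotoneOn f (Set.Ici 0) := by
    refine monotoneOn_of_deriv_nonneg (convex_Ici 0)
      (fun y hy => (hd y hy).continuousAt.continuousWithinAt)
      (fun y hy => (hd y (interior_subset hy)).differentiableAt.differentiableWithinAt)
      fun y hy => ?_
    rw [(hd y (interior_subset hy)).deriv]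
    have hy0 : (0 : ℝ) ≤ y := interior_subset hy
    have : 1 / 2 - -1 / (1 + y) ^ 2 / 2 - 1 / (1 + y) = y ^ 2 / (2 * (1 + y) ^ 2) := by
      field_simp
      ring
    rw [this]; positivity
  have h := hmono (Set.mem_Ici.2 le_rfl) (Set.mem_Ici.2 hx) hx
  have h0 : f 0 = 0 := by simp [f]
  rw [h0] at h
  have e : x * (x + 2) / (2 * (1 + x)) = (1 + x) / 2 - (1 + x)⁻¹ / 2 := by
    field_simp
    ring
  rw [e]
  simp only [f] at h
  linarith

/-- Bounds the gap between log and its chord on [k, k+1]. Half of it, 0.0071, is the loss from 0.978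
to 0.985 in `evenMomentBound_interpolate`. -/
theorem log_add_le_of_three_le {k θ : ℝ} (hk : 3 ≤ k) (h0 : 0 ≤ θ) (h1 : θ ≤ 1) :
    Real.log (k + θ) ≤ (1 - θ) * Real.log k + θ * Real.log (k + 1) + 0.0142 := by
  have hk0 : 0 < k := by linarith
  have a1 := log_one_add_le_of_nonneg (x := θ / k) (by positivity)
  have a2 := Real.le_log_one_add_of_nonneg (x := (1 - θ) / (k + θ))
    (div_nonneg (by linarith) (by linarith))
  have e1 : Real.log (1 + θ / k) = Real.log (k + θ) - Real.log k := by
    rw [← Real.log_div (by positivity) (by positivity)]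
    congr 1; field_simp
  have e2 : Real.log (1 + (1 - θ) / (k + θ)) = Real.log (k + 1) - Real.log (k + θ) := by
    rw [← Real.log_div (by positivity) (by positivity)]
    congr 1; field_simp; ring
  rw [e1] at a1
  rw [e2] at a2
  have b1 := mul_le_mul_of_nonneg_left a1 (sub_nonneg.2 h1)
  have b2 := mul_le_mul_of_nonneg_left a2 h0
  have e3 : (1 - θ) * (θ / k * (θ / k + 2) / (2 * (1 + θ / k))) -
      θ * (2 * ((1 - θ) / (k + θ)) / ((1 - θ) / (k + θ) + 2)) ≤ 0.0142 := by
    have hkk : 0 < 2 * k + 1 + θ := by linarith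
    have f1 : θ / k * (θ / k + 2) / (2 * (1 + θ / k)) = θ * (2 * k + θ) / (2 * k * (k + θ)) := by
      field_simp
      ring
    have f2 : 2 * ((1 - θ) / (k + θ)) / ((1 - θ) / (k + θ) + 2) = 2 * (1 - θ) / (2 * k + 1 + θ) := by
      have : (1 - θ) / (k + θ) + 2 = (2 * k + 1 + θ) / (k + θ) := by field_simp; ring
      rw [this]
      field_simp
    rw [f1, f2]
    have f3 : (1 - θ) * (θ * (2 * k + θ) / (2 * k * (k + θ))) -
        θ * (2 * (1 - θ) / (2 * k + 1 + θ)) =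
        θ * (1 - θ) * ((2 * k + θ * (1 + θ)) / (2 * k * (k + θ) * (2 * k + 1 + θ))) := by
      field_simp
      ring
    have f4 : (2 * k + θ * (1 + θ)) / (2 * k * (k + θ) * (2 * k + 1 + θ)) ≤ 0.0568 := by
      rw [div_le_iff₀ (by positivity)]
      nlinarith [mul_nonneg h0 (by linarith : 0 ≤ k - 3), mul_nonneg h0 h0,
        mul_nonneg (by linarith : 0 ≤ k - 3) (by linarith : 0 ≤ k - 3),
        mul_nonneg (mul_nonneg hk0.le hk0.le) (by linarith : 0 ≤ k - 3),
        mul_nonneg (mul_nonneg hk0.le hk0.le) h0, mul_nonneg hk0.le h0]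
    have f5 : 0 ≤ θ * (1 - θ) := mul_nonneg h0 (by linarith)
    have f6 : θ * (1 - θ) ≤ 1 / 4 := by nlinarith [sq_nonneg (θ - 1 / 2)]
    rw [f3]
    calc _ ≤ 1 / 4 * (0.0568 : ℝ) := by gcongr
      _ = 0.0142 := by norm_num
  nlinarith

theorem evenMomentBound_pos (k : ℕ) (hk : 1 ≤ k) : 0 < evenMomentBound k := by
  unfold evenMomentBound
  have : (0 : ℝ) < k := by exact_mod_cast hk
  split_ifs <;> positivity

theorem evenMomentBound_le (k : ℕ) (hk : 1 ≤ k) : evenMomentBound k ≤ 1 / √k := by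
  unfold evenMomentBound
  have h0 : (0 : ℝ) < k := by exact_mod_cast hk
  split_ifs with h1 h2
  · simp [h1]
  · subst h2
    rw [le_div_iff₀ (by positivity)]
    have : √((2 : ℕ) : ℝ) ≤ 3 / 2 := Real.sqrt_le_iff.2 ⟨by norm_num, by norm_num⟩
    linarith
  · gcongr
    norm_num

theorem evenMomentBound_interpolate {k : ℕ} (hk : 2 ≤ k) {θ : ℝ} (h0 : 0 ≤ θ) (h1 : θ ≤ 1) :
    evenMomentBound k ^ (1 - θ) * evenMomentBound (k + 1) ^ θ ≤ 0.985 / √(k + θ) := by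
  have hk' : (2 : ℝ) ≤ k := by exact_mod_cast hk
  have hp := evenMomentBound_pos k (by omega)
  have hp1 := evenMomentBound_pos (k + 1) (by omega)
  have hkθ : 0 < (k : ℝ) + θ := by linarith
  have hlog3 : ∀ m : ℕ, 3 ≤ m →
      Real.log (evenMomentBound m) = Real.log 0.978 - Real.log m / 2 := by
    intro m hm
    have : (0 : ℝ) < m := by
      have : 0 < m := by omega
      exact_mod_cast this
    rw [evenMomentBound, if_neg (by omega), if_neg (by omega),
      Real.log_div (by norm_num) (by positivity), Real.log_sqrt this.le]
  have hc : Real.log 0.978 + 0.0071 ≤ Real.log 0.985 := by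
    have : Real.log (0.978 / 0.985) ≤ 0.978 / 0.985 - 1 := Real.log_le_sub_one_of_pos (by norm_num)
    rw [Real.log_div (by norm_num) (by norm_num)] at this
    norm_num at this ⊢
    linarith
  rw [← Real.log_le_log_iff (by positivity) (by positivity), Real.log_mul (by positivity)
    (by positivity), Real.log_rpow hp, Real.log_rpow hp1, Real.log_div (by norm_num)
    (by positivity), Real.log_sqrt hkθ.le, hlog3 (k + 1) (by omega)]
  push_cast
  rcases Nat.lt_or_ge k 3 with h | h
  · have hk2 : k = 2 := by omega
    subst hk2
    have e2 : evenMomentBound 2 = 2 / 3 := by norm_num [evenMomentBound]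
    rw [e2]
    push_cast
    have t1 : Real.log (2 + θ) ≤ Real.log 3 + (θ - 1) / 3 := by
      have := Real.log_le_sub_one_of_pos (show 0 < (2 + θ) / 3 by positivity)
      rw [Real.log_div (by positivity) (by norm_num)] at this
      linarith
    -- The exact value 2/3 at k = 2 matters here. The slope 0.17 slightly exceeds the 1/6 supplied
    -- by `t1`, and the slack 0.0071 absorbs the difference.
    have t2 : Real.log (2 / 3) - 0.17 ≤ Real.log 0.978 - Real.log 3 / 2 := by
      have hq := Real.quadratic_le_exp_of_nonneg (show (0 : ℝ) ≤ 0.17 by norm_num)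
      have hs : √3 ≤ 1.7321 := Real.sqrt_le_iff.2 ⟨by norm_num, by norm_num⟩
      have : (2 / 3 : ℝ) ≤ 0.978 / √3 * Real.exp 0.17 := by
        rw [div_mul_eq_mul_div, le_div_iff₀ (by positivity)]
        nlinarith
      have h5 := Real.log_le_log (by norm_num) this
      rw [Real.log_mul (by positivity) (by positivity), Real.log_exp,
        Real.log_div (x := 0.978) (by norm_num) (by positivity),
        Real.log_sqrt (by norm_num)] at h5
      linarith
    norm_num at hc t2 ⊢
    nlinarith
  · rw [hlog3 k h]
    have := log_add_le_of_three_le (k := (k : ℝ)) (by exact_mod_cast h) h0 h1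
    linarith

/-- The tangent line at c of a concave power. Applied to |φ|², it gives Hölder interpolation
directly between upper bounds of two even moments. -/
theorem rpow_le_tangent {x c θ : ℝ} (hx : 0 ≤ x) (hc : 0 < c) (h0 : 0 ≤ θ) (h1 : θ ≤ 1) :
    x ^ θ ≤ c ^ (θ - 1) * (θ * x + (1 - θ) * c) := by
  have h := Real.geom_mean_le_arith_mean2_weighted h0 (sub_nonneg.2 h1) hx hc.le (by ring)
  have h2 : x ^ θ = c ^ (θ - 1) * (x ^ θ * c ^ (1 - θ)) := by
    rw [mul_left_comm, ← Real.rpow_add hc]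
    simp
  rw [h2]
  gcongr

/-- Here 0.98365 is just below 1 - 85/5200 and 1.8 = 2·0.9, with 0.9 the threshold in
`integral_norm_charFun_rpow_tail_le`. The cubic Taylor polynomial of exp leaves a quartic, settled
by Bernstein coefficients. -/
theorem one_le_mul_exp {b : ℝ} (h1 : 1 / 3 ≤ b) (h2 : b ≤ 3 / 4) :
    1 ≤ b * Real.exp (1.8 * (0.98365 - b)) := by
  have hz : 0 ≤ 1.8 * (0.98365 - b) := by linarith
  have h3 := Real.sum_le_exp_of_nonneg hz 4
  simp only [Finset.sum_range_succ, Finset.range_zero, Finset.sum_empty, Nat.factorial] at h3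
  norm_num at h3
  have h4 := mul_le_mul_of_nonneg_left h3 (by linarith : 0 ≤ b)
  refine le_trans ?_ (by norm_num; exact h4)
  have hs : 0 ≤ b - 1 / 3 := by linarith
  have ht : 0 ≤ 3 / 4 - b := by linarith
  linarith [pow_nonneg hs 4, mul_nonneg (pow_nonneg hs 3) ht,
    mul_nonneg (pow_nonneg hs 2) (pow_nonneg ht 2), mul_nonneg hs (pow_nonneg ht 3),
    pow_nonneg ht 4]

theorem integrable_norm_charFun_rpow {μ : Measure ℝ} [IsProbabilityMeasure μ] {M : ℝ} (hM : 0 < M)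
    (hμ : μ ≤ ENNReal.ofReal M • (volume : Measure ℝ)) {s : ℝ} (hs : 2 ≤ s) :
    Integrable fun u => ‖charFun μ u‖ ^ s := by
  have h := (integral_norm_charFun_pow_le_evenMomentBound hM hμ le_rfl).1
  have hm : Measurable fun u => ‖charFun μ u‖ ^ s := by fun_prop
  refine h.mono' hm.aestronglyMeasurable (Filter.Eventually.of_forall fun u => ?_)
  have h1 : ‖charFun μ u‖ ≤ 1 := by simpa using norm_charFun_le (μ := μ) u
  rw [Real.norm_of_nonneg (by positivity), ← Real.rpow_natCast]
  exact Real.rpow_le_rpow_of_exponent_ge_of_imp (norm_nonneg _) h1 (by push_cast; linarith)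
    (fun _ hs0 => by linarith)

/-- Moments of order `s ≥ 4` of the characteristic function of a law with density at most `M`. -/
theorem integral_norm_charFun_rpow_le {μ : Measure ℝ} [IsProbabilityMeasure μ] {M : ℝ} (hM : 0 < M)
    (hμ : μ ≤ ENNReal.ofReal M • (volume : Measure ℝ)) {s : ℝ} (hs : 4 ≤ s) :
    ∫ u, ‖charFun μ u‖ ^ s ≤ 2 * Real.pi * M * (0.985 * √(2 / s)) := by
  set k := ⌊s / 2⌋₊ with hk
  have hk2 : 2 ≤ k := Nat.le_floor (by push_cast; linarith)
  have hks : (k : ℝ) ≤ s / 2 := Nat.floor_le (by linarith)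
  have hks1 : s / 2 < k + 1 := Nat.lt_floor_add_one _
  set θ := s / 2 - k with hθ
  have h0 : 0 ≤ θ := by linarith
  have h1 : θ ≤ 1 := by linarith
  obtain ⟨i1, b1⟩ := integral_norm_charFun_pow_le_evenMomentBound hM hμ (k := k) (by omega)
  obtain ⟨i2, b2⟩ := integral_norm_charFun_pow_le_evenMomentBound hM hμ (k := k + 1) (by omega)
  have p1 := evenMomentBound_pos k (by omega)
  have p2 := evenMomentBound_pos (k + 1) (by omega)
  set S := evenMomentBound k
  set S' := evenMomentBound (k + 1)
  -- Tangency at the ratio of the two bounds makes the result exactly S^{1-θ} S'^θ.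
  set c := S' / S with hc
  have hc0 : 0 < c := by positivity
  have hpt : ∀ u, ‖charFun μ u‖ ^ s ≤ c ^ (θ - 1) * (θ * ‖charFun μ u‖ ^ (2 * (k + 1)) +
      (1 - θ) * c * ‖charFun μ u‖ ^ (2 * k)) := by
    intro u
    have e : ‖charFun μ u‖ ^ s = ‖charFun μ u‖ ^ (2 * k) * (‖charFun μ u‖ ^ 2) ^ θ := by
      rw [← Real.rpow_natCast _ 2, ← Real.rpow_mul (norm_nonneg _), ← Real.rpow_natCast,
        ← Real.rpow_add_of_nonneg (norm_nonneg _) (by positivity) (by positivity)]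
      congr 1
      rw [hθ]; push_cast; ring
    rw [e]
    have := mul_le_mul_of_nonneg_left
      (rpow_le_tangent (sq_nonneg ‖charFun μ u‖) hc0 h0 h1)
      (by positivity : 0 ≤ ‖charFun μ u‖ ^ (2 * k))
    refine this.trans (le_of_eq ?_)
    ring
  calc ∫ u, ‖charFun μ u‖ ^ s ≤ ∫ u, c ^ (θ - 1) * (θ * ‖charFun μ u‖ ^ (2 * (k + 1)) +
      (1 - θ) * c * ‖charFun μ u‖ ^ (2 * k)) :=
        integral_mono (integrable_norm_charFun_rpow hM hμ (by linarith))
          (((i2.const_mul θ).add (i1.const_mul _)).const_mul _) hpt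
    _ = c ^ (θ - 1) * (θ * (∫ u, ‖charFun μ u‖ ^ (2 * (k + 1))) +
      (1 - θ) * c * ∫ u, ‖charFun μ u‖ ^ (2 * k)) := by
        rw [integral_const_mul, integral_add (i2.const_mul θ) (i1.const_mul _),
          integral_const_mul, integral_const_mul]
    _ ≤ c ^ (θ - 1) * (θ * (2 * Real.pi * M * S') + (1 - θ) * c * (2 * Real.pi * M * S)) := by
        have := sub_nonneg.2 h1
        gcongr
    _ = 2 * Real.pi * M * (S ^ (1 - θ) * S' ^ θ) := by
        have e1 : c * S = S' := by rw [hc]; field_simp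
        have e2 : c ^ (θ - 1) * S' = S ^ (1 - θ) * S' ^ θ := by
          rw [hc, Real.div_rpow p2.le p1.le, Real.rpow_sub_one p2.ne',
            show θ - 1 = -(1 - θ) by ring, Real.rpow_neg p1.le]
          field_simp
        rw [← e2]
        linear_combination (1 - θ) * c ^ (θ - 1) * (2 * Real.pi * M) * e1
    _ ≤ 2 * Real.pi * M * (0.985 / √(k + θ)) := by
        have := evenMomentBound_interpolate hk2 h0 h1
        gcongr
    _ = _ := by
        rw [hθ, add_sub_cancel, div_eq_mul_inv, ← Real.sqrt_inv, inv_div]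

/-! ### The tail integral and the reduction to it. -/

theorem integral_norm_charFun_rpow_tail_le {μ : Measure ℝ} [IsProbabilityMeasure μ] {M : ℝ}
    (hM : 0 < M) (hμ : μ ≤ ENNReal.ofReal M • (volume : Measure ℝ)) (hL : MemLp id 2 μ)
    (hV : Var[id; μ] = 1) {ε : ℝ} (hε : 0 < ε) (hε1 : ε ≤ 1) {s : ℝ} (hs : 4 ≤ s) :
    ∫ u in {u : ℝ | ε ≤ |u|}, ‖charFun μ u‖ ^ s ≤
      2 * Real.pi * M * √(2 / s) * Real.exp (-(s * ε ^ 2 / (5200 * M ^ 2))) := by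
  have hmeasS : MeasurableSet {u : ℝ | ε ≤ |u|} := measurableSet_le measurable_const (by fun_prop)
  have hint := integrable_norm_charFun_rpow hM hμ (s := s) (by linarith)
  set y := s * ε ^ 2 / (85 * M ^ 2) with hy
  have hy' : s * ε ^ 2 / (5200 * M ^ 2) = y * (85 / 5200) := by
    rw [hy]; field_simp
  have hy0 : 0 ≤ y := by positivity
  rw [hy']
  -- Up to 0.9 the exponential is at least 1 - 0.9·85/5200 > 0.985, so the full moment bound is
  -- enough.
  rcases le_total y 0.9 with h | h
  · calc ∫ u in {u : ℝ | ε ≤ |u|}, ‖charFun μ u‖ ^ s ≤ ∫ u, ‖charFun μ u‖ ^ s :=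
          setIntegral_le_integral hint (Filter.Eventually.of_forall fun u => by positivity)
      _ ≤ 2 * Real.pi * M * (0.985 * √(2 / s)) := integral_norm_charFun_rpow_le hM hμ hs
      _ = 2 * Real.pi * M * √(2 / s) * 0.985 := by ring
      _ ≤ _ := by
          have := Real.add_one_le_exp (-(y * (85 / 5200)))
          gcongr
          linarith
  · set k := ⌊s / 2⌋₊ with hk
    have hk2 : 2 ≤ k := Nat.le_floor (by push_cast; linarith)
    have hks : (k : ℝ) ≤ s / 2 := Nat.floor_le (by linarith)
    have hks1 : s / 2 < k + 1 := Nat.lt_floor_add_one _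
    -- The even exponent 2j is about s/2. Its share b = 2j/s goes to the moment bound, at the cost
    -- of a factor 1/√b, and the share 1 - b gives the decay exp(-(1-b)y).
    set j := (k + 1) / 2 with hj
    have hj1 : 1 ≤ j := by omega
    have hj1' : (1 : ℝ) ≤ j := by exact_mod_cast hj1
    have g1 : s ≤ 6 * j := by
      have : k + 1 ≤ 3 * j := by omega
      have : (k : ℝ) + 1 ≤ 3 * j := by exact_mod_cast this
      linarith
    have g2 : 8 * j ≤ 3 * s := by
      have : 4 * j ≤ 3 * k := by omega
      have : 4 * (j : ℝ) ≤ 3 * k := by exact_mod_cast this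
      linarith
    set b := 2 * j / s with hb
    have hb1 : 1 / 3 ≤ b := by rw [hb, le_div_iff₀ (by linarith)]; linarith
    have hb2 : b ≤ 3 / 4 := by rw [hb, div_le_iff₀ (by linarith)]; linarith
    have hjs : (2 * j : ℝ) ≤ s := by linarith
    obtain ⟨i1, b1⟩ := integral_norm_charFun_pow_le_evenMomentBound hM hμ hj1
    set E := Real.exp (-((1 - b) * y)) with hE
    have hpt : ∀ u ∈ {u : ℝ | ε ≤ |u|}, ‖charFun μ u‖ ^ s ≤ E * ‖charFun μ u‖ ^ (2 * j) := by
      intro u hu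
      have h1 := norm_charFun_le_exp hM hμ hL hV hε hε1 hu
      have e : ‖charFun μ u‖ ^ s = ‖charFun μ u‖ ^ (s - 2 * j) * ‖charFun μ u‖ ^ (2 * j) := by
        rw [← Real.rpow_natCast, ← Real.rpow_add_of_nonneg (norm_nonneg _) (by linarith)
          (by positivity)]
        congr 1
        push_cast; ring
      rw [e]
      gcongr
      calc ‖charFun μ u‖ ^ (s - 2 * j) ≤ Real.exp (-(ε ^ 2 / (85 * M ^ 2))) ^ (s - 2 * j) := by
            gcongr
        _ = E := by
            rw [hE, ← Real.exp_mul, hb, hy]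
            congr 1
            field_simp
    have hfin : 1 / √j * E ≤ √(2 / s) * Real.exp (-(y * (85 / 5200))) := by
      have h1 := one_le_mul_exp hb1 hb2
      have h2 : 1.8 * (0.98365 - b) ≤ 2 * ((1 - b - 85 / 5200) * y) := by
        have : (0 : ℝ) ≤ 1 - b - 85 / 5200 := by linarith
        nlinarith
      have h3 : 1 ≤ b * Real.exp ((1 - b - 85 / 5200) * y) ^ 2 := by
        refine h1.trans ?_
        rw [← Real.exp_nat_mul]
        exact mul_le_mul_of_nonneg_left (Real.exp_le_exp.2 (by push_cast; exact h2)) (by linarith)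
      have h4 : 1 ≤ √b * Real.exp ((1 - b - 85 / 5200) * y) := by
        rw [← Real.sqrt_sq (Real.exp_pos ((1 - b - 85 / 5200) * y)).le,
          ← Real.sqrt_mul (by linarith)]
        exact Real.one_le_sqrt.2 h3
      have h5 : √(2 / s) = √b * (1 / √j) := by
        have : 2 / s = b * (1 / j) := by rw [hb]; field_simp
        rw [this, Real.sqrt_mul (by linarith), Real.sqrt_div zero_le_one, Real.sqrt_one]
      have h6 : Real.exp (-(y * (85 / 5200))) = Real.exp ((1 - b - 85 / 5200) * y) * E := by
        rw [hE, ← Real.exp_add]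
        congr 1; ring
      rw [h5, h6]
      have h7 : 0 ≤ 1 / √j * E := by positivity
      calc 1 / √j * E ≤ (1 / √j * E) * (√b * Real.exp ((1 - b - 85 / 5200) * y)) :=
            le_mul_of_one_le_right h7 h4
        _ = _ := by ring
    calc ∫ u in {u : ℝ | ε ≤ |u|}, ‖charFun μ u‖ ^ s
        ≤ ∫ u in {u : ℝ | ε ≤ |u|}, E * ‖charFun μ u‖ ^ (2 * j) :=
          setIntegral_mono_on hint.integrableOn (i1.const_mul E).integrableOn hmeasS hpt
      _ ≤ ∫ u, E * ‖charFun μ u‖ ^ (2 * j) :=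
          setIntegral_le_integral (i1.const_mul E)
            (Filter.Eventually.of_forall fun u => by positivity)
      _ = E * ∫ u, ‖charFun μ u‖ ^ (2 * j) := integral_const_mul _ _
      _ ≤ E * (2 * Real.pi * M * (1 / √j)) := by
          have h1 := evenMomentBound_le j hj1
          have h2 : 2 * Real.pi * M * evenMomentBound j ≤ 2 * Real.pi * M * (1 / √j) := by gcongr
          have := b1.trans h2
          gcongr
      _ = 2 * Real.pi * M * (1 / √j * E) := by ring
      _ ≤ 2 * Real.pi * M * (√(2 / s) * Real.exp (-(y * (85 / 5200)))) := by gcongr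
      _ = _ := by ring

/-- An infinite extended variance is converted to the real value 0, so a nonzero variance forces a
finite second moment. -/
theorem memLp_two_of_variance_ne_zero {Ω : Type*} [MeasurableSpace Ω] {P : Measure Ω}
    [IsFiniteMeasure P] {X : Ω → ℝ} (hX : AEMeasurable X P) (h : Var[X; P] ≠ 0) :
    MemLp X 2 P := by
  rw [← evariance_lt_top_iff_memLp hX.aestronglyMeasurable, lt_top_iff_ne_top]
  intro htop
  exact h (by rw [variance, htop, ENNReal.toReal_top])

theorem HasDensityBoundedBy.map_le {Ω : Type*} [MeasurableSpace Ω] {P : Measure Ω} {Z : Ω → ℝ}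
    {M : ℝ} (h : HasDensityBoundedBy P Z M) :
    P.map Z ≤ ENNReal.ofReal M • (volume : Measure ℝ) := by
  obtain ⟨p, -, -, hpM, hp⟩ := h
  rw [hp, ← withDensity_const]
  exact withDensity_mono (Filter.Eventually.of_forall fun x => ENNReal.ofReal_le_ofReal (hpM x))

theorem pos_of_le_ofReal_smul_volume {μ : Measure ℝ} [IsProbabilityMeasure μ] {M : ℝ}
    (h : μ ≤ ENNReal.ofReal M • (volume : Measure ℝ)) : 0 < M := by
  by_contra hM
  rw [ENNReal.ofReal_of_nonpos (not_lt.1 hM), zero_smul] at h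
  have := h Set.univ
  simp at this

theorem variance_normalizedSum {Ω : Type*} [MeasurableSpace Ω] {P : Measure Ω}
    [IsProbabilityMeasure P] {Xs : ℕ → Ω → ℝ} (hindep : iIndepFun Xs P)
    (hL : ∀ i, MemLp (Xs i) 2 P) (hV : ∀ i, Var[Xs i; P] = 1) {n : ℕ} (hn : 1 ≤ n) :
    MemLp (normalizedSum Xs n) 2 P ∧ Var[normalizedSum Xs n; P] = 1 := by
  have e : normalizedSum Xs n = fun ω => (√(n : ℝ))⁻¹ * (∑ i ∈ Finset.range n, Xs i) ω := by
    ext ω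
    rw [normalizedSum, Finset.sum_apply, div_eq_inv_mul]
  have hn' : (n : ℝ) ≠ 0 := by positivity
  rw [e]
  refine ⟨(memLp_finsetSum' _ fun i _ => hL i).const_mul _, ?_⟩
  rw [variance_const_mul, IndepFun.variance_sum (fun i _ => hL i)
    (fun i _ j _ hij => hindep.indepFun hij)]
  simp [hV]
  field_simp

theorem corollary3p3 {Ω Ω' : Type*} [MeasurableSpace Ω] [MeasurableSpace Ω']
    (P : Measure Ω) [IsProbabilityMeasure P] (P' : Measure Ω') [IsProbabilityMeasure P']
    (X : Ω → ℝ) (hX : AEMeasurable X P) (hVar : Var[X; P] = 1)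
    (Xs : ℕ → Ω' → ℝ) (hindep : iIndepFun Xs P') (hcopy : ∀ i, IdentDistrib (Xs i) X P' P)
    (n₀ : ℕ) (hn₀ : 1 ≤ n₀) (M : ℝ)
    (hdens : HasDensityBoundedBy P' (normalizedSum Xs n₀) M)
    (ε : ℝ) (hε : 0 < ε) (hε1 : ε ≤ 1) (n : ℕ) (hn : 4 * n₀ ≤ n) :
    IntegrableOn (fun t : ℝ => ‖charFun (P.map X) t‖ ^ n) {t : ℝ | ε ≤ |t|} ∧
      ∫ t in {t : ℝ | ε ≤ |t|}, ‖charFun (P.map X) t‖ ^ n ≤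
        4 * Real.pi * M / √(2 * (n : ℝ)) *
          Real.exp (-((n : ℝ) * ε ^ 2 / (5200 * (n₀ : ℝ) * M ^ 2))) := by
  have hXL : MemLp X 2 P := memLp_two_of_variance_ne_zero hX (by rw [hVar]; exact one_ne_zero)
  obtain ⟨hZL, hZV⟩ := variance_normalizedSum hindep (fun i => (hcopy i).memLp_iff.2 hXL)
    (fun i => (hcopy i).variance_eq.trans hVar) hn₀
  have hZ : AEMeasurable (normalizedSum Xs n₀) P' := hZL.aestronglyMeasurable.aemeasurable
  set μ := P'.map (normalizedSum Xs n₀) with hμdef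
  have : IsProbabilityMeasure μ := Measure.isProbabilityMeasure_map hZ
  have hμ : μ ≤ ENNReal.ofReal M • (volume : Measure ℝ) := hdens.map_le
  have hM : 0 < M := pos_of_le_ofReal_smul_volume hμ
  have hL : MemLp id 2 μ := (memLp_map_measure_iff (by fun_prop) hZ).2 hZL
  have hV : Var[id; μ] = 1 := by
    rw [hμdef, variance_map (by fun_prop) hZ, Function.id_comp, hZV]
  have hn₀' : (0 : ℝ) < n₀ := by exact_mod_cast hn₀
  set c := √(n₀ : ℝ) with hc
  have hc1 : 1 ≤ c := Real.one_le_sqrt.2 (by exact_mod_cast hn₀)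
  have hcpos : 0 < c := by linarith
  set s : ℝ := n / n₀ with hs
  have hs4 : 4 ≤ s := by
    rw [hs, le_div_iff₀ hn₀']; exact_mod_cast hn
  have hchar : ∀ t, ‖charFun (P.map X) t‖ ^ n = ‖charFun μ (c * t)‖ ^ s := by
    intro t
    have h1 := charFun_inv_sqrt_mul_sum (t := c * t) (n := n₀) hindep
      (fun i => (hcopy i).trans (hcopy 0).symm)
    have e : (fun ω => (√(n₀ : ℝ))⁻¹ * ∑ k ∈ Finset.range n₀, Xs k ω) = normalizedSum Xs n₀ := by
      ext ω
      rw [normalizedSum, div_eq_inv_mul]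
    rw [e, ← hμdef, ← hc, inv_mul_cancel_left₀ hcpos.ne', (hcopy 0).map_eq] at h1
    rw [h1, norm_pow, ← Real.rpow_natCast, ← Real.rpow_natCast, ← Real.rpow_mul (norm_nonneg _)]
    congr 1
    rw [hs]; field_simp
  simp_rw [hchar]
  have hint := integrable_norm_charFun_rpow hM hμ (s := s) (by linarith)
  have hint' : Integrable fun t => ‖charFun μ (c * t)‖ ^ s := hint.comp_mul_left' hcpos.ne'
  refine ⟨hint'.integrableOn, ?_⟩
  have hmeasS : MeasurableSet {u : ℝ | ε ≤ |u|} := measurableSet_le measurable_const (by fun_prop)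
  set G : ℝ → ℝ := {u : ℝ | ε ≤ |u|}.indicator fun u => ‖charFun μ u‖ ^ s with hG
  have hGI : Integrable G := hint.indicator hmeasS
  -- As c = √n₀ ≥ 1, |t| ≥ ε implies |ct| ≥ ε; enlarging the domain this way leaves only the factor
  -- 1/c from rescaling.
  have hle : ∫ t in {u : ℝ | ε ≤ |u|}, ‖charFun μ (c * t)‖ ^ s ≤ ∫ t, G (c * t) := by
    rw [← integral_indicator hmeasS]
    refine integral_mono (hint'.indicator hmeasS) (hGI.comp_mul_left' hcpos.ne') fun t => ?_
    by_cases ht : t ∈ {u : ℝ | ε ≤ |u|}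
    · have ht' : c * t ∈ {u : ℝ | ε ≤ |u|} := by
        have : ε ≤ |t| := ht
        rw [Set.mem_ofPred_eq, abs_mul, abs_of_pos hcpos]
        nlinarith [abs_nonneg t]
      simp only
      rw [hG, Set.indicator_of_mem ht, Set.indicator_of_mem ht']
    · simp only
      rw [Set.indicator_of_notMem ht]
      exact Set.indicator_nonneg (fun u _ => by positivity) _
  refine hle.trans ?_
  rw [Measure.integral_comp_mul_left, hG, integral_indicator hmeasS, abs_of_pos (by positivity),
    smul_eq_mul]
  have hfinal := integral_norm_charFun_rpow_tail_le hM hμ hL hV hε hε1 hs4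
  have hn' : (0 : ℝ) < n := by
    have : 0 < n := by omega
    exact_mod_cast this
  have e1 : s * ε ^ 2 / (5200 * M ^ 2) = n * ε ^ 2 / (5200 * n₀ * M ^ 2) := by
    rw [hs]; field_simp
  have e2 : c⁻¹ * (2 * Real.pi * M * √(2 / s)) = 4 * Real.pi * M / √(2 * (n : ℝ)) := by
    have h1 : √(2 / s) = c * (2 / √(2 * (n : ℝ))) := by
      rw [← Real.sqrt_sq (show (0 : ℝ) ≤ 2 / √(2 * (n : ℝ)) by positivity), hc,
        ← Real.sqrt_mul hn₀'.le, div_pow, Real.sq_sqrt (by positivity), hs]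
      congr 1
      field_simp
    rw [h1]
    field_simp
    norm_num
  rw [e1] at hfinal
  calc c⁻¹ * ∫ u in {u : ℝ | ε ≤ |u|}, ‖charFun μ u‖ ^ s
      ≤ c⁻¹ * (2 * Real.pi * M * √(2 / s) *
        Real.exp (-(n * ε ^ 2 / (5200 * n₀ * M ^ 2)))) := by gcongr
    _ = _ := by rw [← e2]; ring
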